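/- Let $\mathbb T=[t_0,t_1]$ with $t_0<t_1$. A linear time-varying system $$E\dot z=(J-R-EK)z+Gu,\qquad y=G^Tz \qquad (1)$$ with state $z(t)\in\mathbb R^n$, input $u(t)$ and output $y(t)\in\mathbb R^m$, $E\in C^1$ and $J,R,K,G$ continuous on $\mathbb T$, is called a pHDAE (with $Q=I$ and without feedthrough) if pointwise $E=E^T$, $\dot E=(EK-J)+(EK-J)^T$ and $R=R^T\ge 0$. Its Hamiltonian is $\mathcal H(t,z)=\tfrac12 z^TE(t)z$. A solution is a $C^1$ function $z$ satisfying the state equation pointwise on $\mathbb T$. Consider a pHDAE (1) of the reduced form $$E=\begin{bmatrix}E_1&0\\0&0\end{bmatrix},\quad J=\begin{bmatrix}J_1&0\\0&0\end{bmatrix},\quad R=\begin{bmatrix}R_1&0\\0&0\end{bmatrix},\quad K=\begin{bmatrix}K_1&0\\0&0\end{bmatrix},\quad G=\begin{bmatrix}G_1\\G_2\end{bmatrix}$$ with $n=n_1+n_2$ and non-negative Hamiltonian, where $J_1,R_1,G_1,G_2$ are continuously differentiable, $G_2(t)\in\mathbb R^{n_2\times m}$ has full row rank for every $t\in\mathbb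 T$, and the system $E_1\dot z_1=(J_1-R_1-E_1K_1)z_1+G_1u$ is regular: for every sufficiently often differentiable $u$ it has a solution, and a solution is uniquely determined by its initial value at $t_0$. For $t\in\mathbb T$ put $$\mathcal N(t)=\{x\in\ker E(t): y^T(J(t)-R(t))x=0\ \text{for all } y\in\ker E(t)\}.$$ Assume that the following numbers do not depend on $t$ (constant rank assumptions): $\operatorname{rank}E(t)$, $\dim\mathcal N(t)$, $\dim\big((J(t)-R(t))^T\mathcal N(t)\big)$ and $\dim\big(G(t)^T\mathcal N(t)\big)$. Then there are pointwise orthogonal $V\in C^1(\mathbb T,\mathbb R^{n,n})$ and $U\in C^1(\mathbb T,\mathbb R^{m,m})$, partitions of $n$ into six and of $m$ into three (possibly void) blocks, and a pHDAE $$\hat E\dot{\hat z}=(\hat J-\hat R-\hat E\hat K)\hat z+\hat G\hat u,\qquad \hat y=\hat G^T\hat z \qquad (2)$$ such that $(z,u,y)$ satisfies (1) if and only if $(\hat z,\hat u,\hat y)=(V^Tz,U^Tu,U^Ty)$ satisfies (2), with coefficients $$\hat E=V^TEV,\quad \hat R=V^TRV,\quad \hat G=V^TGU,\quad \hat J-\hat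 R-\hat E\hat K=V^T(J-R-EK)V-V^TE\dot V$$ (and $\hat J=V^TJV$ if $J$ is pointwise skew-symmetric), of the form $$\hat E=\begin{bmatrix}E_{11}&E_{12}&0&0&0&0\\E_{21}&E_{22}&0&0&0&0\\0&0&0&0&0&0\\0&0&0&0&0&0\\0&0&0&0&0&0\\0&0&0&0&0&0\end{bmatrix},\quad \hat G=\begin{bmatrix}G_{11}&G_{12}&G_{13}\\G_{21}&G_{22}&G_{23}\\G_{31}&G_{32}&G_{33}\\0&G_{42}&G_{43}\\0&0&G_{53}\\0&0&G_{63}\end{bmatrix},\quad \hat K=\begin{bmatrix}K_{11}&K_{12}&K_{13}&K_{14}&0&0\\K_{21}&K_{22}&K_{23}&K_{24}&0&0\\0&0&0&0&0&0\\0&0&0&0&0&0\\0&0&0&0&0&0\\0&0&0&0&0&0\end{bmatrix},$$ $$\hat J-\hat R=\begin{bmatrix}J_{11}-R_{11}&J_{12}-R_{12}&J_{13}-R_{13}&J_{14}&J_{15}&0\\J_{21}-R_{21}&J_{22}-R_{22}&J_{23}-R_{23}&J_{24}&0&0\\J_{31}-R_{31}&J_{32}-R_{32}&J_{33}-R_{33}&0&0&0\\J_{41}&J_{42}&0&0&0&0\\J_{51}&0&0&0&0&0\\0&0&0&0&0&0\end{bmatrix},$$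 where the blocks $J_{ij}$ of $\hat J$ and $R_{ij}$ of $\hat R$ that are not displayed vanish, and $E_{22}$, $J_{33}-R_{33}$, $J_{15}$, $G_{42}$ and $G_{63}$ are (square and) pointwise invertible. Consequently, every solution of (2) satisfies $\hat u_3=0$ and $\hat z_1=0$ on $\mathbb T$, and $\hat z_5$ is uniquely determined by $\hat u$ and the other components of $\hat z$; these are the parts that need regularization by output feedback. -/

import Mathlib

open Matrix

/-- A matrix function that is continuously differentiable on `T` (entrywise). -/
def MatC1On {m n : Type} (M : ℝ → Matrix m n ℝ) (T : Set ℝ) : Prop :=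
  ∀ i j, ContDiffOn ℝ 1 (fun t => M t i j) T

/-- The entrywise time derivative of a matrix function on `T` (one-sided at end points). -/
noncomputable def matDeriv {m n : Type} (M : ℝ → Matrix m n ℝ) (T : Set ℝ) (t : ℝ) :
    Matrix m n ℝ :=
  Matrix.of fun i j => derivWithin (fun s => M s i j) T t

/-- Coefficients of a linear time-varying system with `Q = I` and without feedthrough,
`E ż = (J - R - E K) z + G u`, `y = Gᵀ z`. -/
structure LTVSystem (n m : Type) where
  E : ℝ → Matrix n n ℝ
  J : ℝ → Matrix n n ℝ
  R : ℝ → Matrix n n ℝ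
  K : ℝ → Matrix n n ℝ
  G : ℝ → Matrix n m ℝ

namespace LTVSystem

/-- The coefficient `J - R - E K` of the state. -/
def A {n m : Type} [Fintype n] (s : LTVSystem n m) (t : ℝ) : Matrix n n ℝ :=
  s.J t - s.R t - s.E t * s.K t

/-- The system is a linear time-varying port-Hamiltonian descriptor system on `T` (with `Q = I`,
`P = 0`, `S = N = 0`): the operator `E d/dt - (J - E K)` is skew-adjoint and the dissipation
matrix is positive semidefinite. As usual in the time-varying case, `J` itself is not required
to be skew-symmetric. -/
structure IsPHDAE {n m : Type} [Fintype n] (s : LTVSystem n m) (T : Set ℝ) : Prop where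
  E_C1 : MatC1On s.E T
  J_cont : ContinuousOn s.J T
  R_cont : ContinuousOn s.R T
  K_cont : ContinuousOn s.K T
  G_cont : ContinuousOn s.G T
  E_symm : ∀ t ∈ T, (s.E t)ᵀ = s.E t
  skew_adjoint : ∀ t ∈ T,
    matDeriv s.E T t = (s.E t * s.K t - s.J t) + (s.E t * s.K t - s.J t)ᵀ
  R_psd : ∀ t ∈ T, (s.R t).PosSemidef

/-- The quadratic Hamiltonian `½ zᵀ E(t) z`. -/
noncomputable def hamiltonian {n m : Type} [Fintype n] (s : LTVSystem n m) (t : ℝ) (z : n → ℝ) :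
    ℝ :=
  (1 / 2) * (z ⬝ᵥ (s.E t *ᵥ z))

/-- `z` is a (classical, continuously differentiable) solution of the state equation on `T` for
the input `u`. -/
def IsStateSolution {n m : Type} [Fintype n] [Fintype m] (s : LTVSystem n m) (T : Set ℝ)
    (z : ℝ → n → ℝ) (u : ℝ → m → ℝ) : Prop :=
  ContDiffOn ℝ 1 z T ∧
    ∀ t ∈ T, s.E t *ᵥ derivWithin z T t = s.A t *ᵥ z t + s.G t *ᵥ u t

/-- `(z, u, y)` is a behavior solution on `T` (state and output equation). -/
def IsSolution {n m : Type} [Fintype n] [Fintype m] (s : LTVSystem n m) (T : Set ℝ)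
    (z : ℝ → n → ℝ) (u y : ℝ → m → ℝ) : Prop :=
  s.IsStateSolution T z u ∧ ∀ t ∈ T, y t = (s.G t)ᵀ *ᵥ z t

/-- Regularity on `[t₀, t₁]`: for every sufficiently smooth input the state equation is solvable,
and its solution is unique for every consistent initial value. -/
def IsRegular {n m : Type} [Fintype n] [Fintype m] (s : LTVSystem n m) (t₀ t₁ : ℝ) : Prop :=
  ∃ k : ℕ, ∀ u : ℝ → m → ℝ, ContDiffOn ℝ k u (Set.Icc t₀ t₁) →
    (∃ z, s.IsStateSolution (Set.Icc t₀ t₁) z u) ∧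
    ∀ z w, s.IsStateSolution (Set.Icc t₀ t₁) z u → s.IsStateSolution (Set.Icc t₀ t₁) w u →
      z t₀ = w t₀ → Set.EqOn z w (Set.Icc t₀ t₁)

/-- The system with state `(z₁, z₂)` in which `z₂` enters only through the input matrix:
`diag(E₁, 0) ż = diag(J₁ - R₁ - E₁ K₁, 0) z + [G₁; G₂] u`, `y = [G₁ᵀ G₂ᵀ] z`. -/
def augment {n₁ n₂ m : Type} (s : LTVSystem n₁ m) (G₂ : ℝ → Matrix n₂ m ℝ) :
    LTVSystem (n₁ ⊕ n₂) m where
  E t := fromBlocks (s.E t) 0 0 0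
  J t := fromBlocks (s.J t) 0 0 0
  R t := fromBlocks (s.R t) 0 0 0
  K t := fromBlocks (s.K t) 0 0 0
  G t := fromRows (s.G t) (G₂ t)

/-- The kernel of the compression of `J(t) - R(t)` to `ker E(t)`. If the columns of `Z` form a
basis of `ker E(t)`, it consists of the vectors `Z a` with `Zᵀ (J(t) - R(t)) Z a = 0`. -/
def algKernel {n m : Type} [Fintype n] (s : LTVSystem n m) (t : ℝ) : Submodule ℝ (n → ℝ) where
  carrier := {x | s.E t *ᵥ x = 0 ∧
    ∀ y, s.E t *ᵥ y = 0 → y ⬝ᵥ ((s.J t - s.R t) *ᵥ x) = 0}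
  zero_mem' := by simp
  add_mem' := by
    rintro a b ⟨ha, ha'⟩ ⟨hb, hb'⟩
    refine ⟨by rw [mulVec_add, ha, hb, add_zero], fun y hy => ?_⟩
    rw [mulVec_add, dotProduct_add, ha' y hy, hb' y hy, add_zero]
  smul_mem' := by
    rintro c a ⟨ha, ha'⟩
    refine ⟨by rw [mulVec_smul, ha, smul_zero], fun y hy => ?_⟩
    rw [mulVec_smul, dotProduct_smul, ha' y hy, smul_zero]

/-- The constant rank assumptions. With columns of `Z` a basis of `ker E`, and columns of `N` a
basis of `algKernel`, they say that the ranks of `E`, `Zᵀ (J - R) Z`, `Nᵀ (J - R)` and `Nᵀ G`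
do not depend on time. (The rank of `Zᵀ (J - R) Z` is the difference of the dimensions of `ker E`
and `algKernel`.) -/
def HasConstantRanks {n m : Type} [Fintype n] [Fintype m] (s : LTVSystem n m) (T : Set ℝ) :
    Prop :=
  ∃ r₁ r₂ r₃ r₄ : ℕ, ∀ t ∈ T,
    (s.E t).rank = r₁ ∧
    Module.finrank ℝ (s.algKernel t) = r₂ ∧
    Module.finrank ℝ ((s.algKernel t).map ((s.J t - s.R t)ᵀ).mulVecLin) = r₃ ∧
    Module.finrank ℝ ((s.algKernel t).map ((s.G t)ᵀ).mulVecLin) = r₄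

end LTVSystem

/-- Pointwise orthogonality on `T`. Rows and columns may carry different index types. -/
def IsOrthogonalOn {m n : Type} [Fintype m] [Fintype n] [DecidableEq m] [DecidableEq n]
    (V : ℝ → Matrix m n ℝ) (T : Set ℝ) : Prop :=
  ∀ t ∈ T, (V t)ᵀ * V t = 1 ∧ V t * (V t)ᵀ = 1

/-- Invertibility of a matrix whose rows and columns carry possibly different index types; it
forces the matrix to be square. -/
def IsInvertibleMatrix {m n : Type} [Fintype m] [Fintype n] [DecidableEq m] [DecidableEq n]
    (M : Matrix m n ℝ) : Prop :=
  ∃ B : Matrix n m ℝ, M * B = 1 ∧ B * M = 1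

/-- Index type of vectors that are partitioned into `k` blocks of sizes `d 0, …, d (k - 1)`
(possibly void). -/
abbrev BlockIdx {k : ℕ} (d : Fin k → ℕ) : Type := Σ i : Fin k, Fin (d i)

/-- The block of `M` in block row `i` and block column `j` (counted from `0`). -/
def blk {k l : ℕ} {d : Fin k → ℕ} {e : Fin l → ℕ} (M : Matrix (BlockIdx d) (BlockIdx e) ℝ)
    (i : Fin k) (j : Fin l) : Matrix (Fin (d i)) (Fin (e j)) ℝ :=
  Matrix.of fun a b => M ⟨i, a⟩ ⟨j, b⟩

/-- The blocks of `M` vanish wherever the pattern has a zero. -/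
def HasPattern {k l : ℕ} {d : Fin k → ℕ} {e : Fin l → ℕ} (M : Matrix (BlockIdx d) (BlockIdx e) ℝ)
    (pat : Matrix (Fin k) (Fin l) ℕ) : Prop :=
  ∀ i j, pat i j = 0 → blk M i j = 0

/-- Zero pattern of `E` in the condensed form. -/
def patternE : Matrix (Fin 6) (Fin 6) ℕ :=
  !![1, 1, 0, 0, 0, 0;
     1, 1, 0, 0, 0, 0;
     0, 0, 0, 0, 0, 0;
     0, 0, 0, 0, 0, 0;
     0, 0, 0, 0, 0, 0;
     0, 0, 0, 0, 0, 0]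

/-- Zero pattern of `J` in the condensed form. -/
def patternJ : Matrix (Fin 6) (Fin 6) ℕ :=
  !![1, 1, 1, 1, 1, 0;
     1, 1, 1, 1, 0, 0;
     1, 1, 1, 0, 0, 0;
     1, 1, 0, 0, 0, 0;
     1, 0, 0, 0, 0, 0;
     0, 0, 0, 0, 0, 0]

/-- Zero pattern of `R` in the condensed form. -/
def patternR : Matrix (Fin 6) (Fin 6) ℕ :=
  !![1, 1, 1, 0, 0, 0;
     1, 1, 1, 0, 0, 0;
     1, 1, 1, 0, 0, 0;
     0, 0, 0, 0, 0, 0;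
     0, 0, 0, 0, 0, 0;
     0, 0, 0, 0, 0, 0]

/-- Zero pattern of `K` in the condensed form. -/
def patternK : Matrix (Fin 6) (Fin 6) ℕ :=
  !![1, 1, 1, 1, 0, 0;
     1, 1, 1, 1, 0, 0;
     0, 0, 0, 0, 0, 0;
     0, 0, 0, 0, 0, 0;
     0, 0, 0, 0, 0, 0;
     0, 0, 0, 0, 0, 0]

/-- Zero pattern of `G` in the condensed form. -/
def patternG : Matrix (Fin 6) (Fin 3) ℕ :=
  !![1, 1, 1;
     1, 1, 1;
     1, 1, 1;
     0, 1, 1;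
     0, 0, 1;
     0, 0, 1]

/-- The six-block condensed form: zero patterns of the coefficients, and pointwise invertibility
of the blocks `E₂₂`, `J₃₃ - R₃₃`, `J₁₅`, `G₄₂` and `G₆₃` (in the usual numbering from `1`). -/
structure IsCondensedForm {d : Fin 6 → ℕ} {e : Fin 3 → ℕ}
    (c : LTVSystem (BlockIdx d) (BlockIdx e)) (T : Set ℝ) : Prop where
  E_pattern : ∀ t ∈ T, HasPattern (c.E t) patternE
  J_pattern : ∀ t ∈ T, HasPattern (c.J t) patternJ
  R_pattern : ∀ t ∈ T, HasPattern (c.R t) patternR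
  K_pattern : ∀ t ∈ T, HasPattern (c.K t) patternK
  G_pattern : ∀ t ∈ T, HasPattern (c.G t) patternG
  E22_inv : ∀ t ∈ T, IsInvertibleMatrix (blk (c.E t) 1 1)
  JR33_inv : ∀ t ∈ T, IsInvertibleMatrix (blk (c.J t - c.R t) 2 2)
  J15_inv : ∀ t ∈ T, IsInvertibleMatrix (blk (c.J t) 0 4)
  G42_inv : ∀ t ∈ T, IsInvertibleMatrix (blk (c.G t) 3 1)
  G63_inv : ∀ t ∈ T, IsInvertibleMatrix (blk (c.G t) 5 2)

/-- The coefficients of `c` are those of `s` after the change of variables `z = V ẑ`, `u = U û`,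
`y = U ŷ`, multiplying the state equation by `Vᵀ` and the output equation by `Uᵀ`. -/
structure IsCongruent {n m n' m' : Type} [Fintype n] [Fintype m] [Fintype n'] [Fintype m']
    (s : LTVSystem n m) (c : LTVSystem n' m') (V : ℝ → Matrix n n' ℝ) (U : ℝ → Matrix m m' ℝ)
    (T : Set ℝ) : Prop where
  E_eq : ∀ t ∈ T, c.E t = (V t)ᵀ * s.E t * V t
  R_eq : ∀ t ∈ T, c.R t = (V t)ᵀ * s.R t * V t
  A_eq : ∀ t ∈ T, c.A t = (V t)ᵀ * s.A t * V t - (V t)ᵀ * s.E t * matDeriv V T t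
  G_eq : ∀ t ∈ T, c.G t = (V t)ᵀ * s.G t * U t
  J_eq_of_skew : (∀ t ∈ T, (s.J t)ᵀ = -s.J t) → ∀ t ∈ T, c.J t = (V t)ᵀ * s.J t * V t

/-!
Compressed to `ker E`, the relation `Ė = (E K - J) + (E K - J)ᵀ` says that `J` is skew-symmetric
there, so that `R` vanishes on `𝒩`. A `C¹` curve `w` in `𝒩` with `(J - R)ᵀ w = 0` then solves the
homogeneous state equation, and so does `(t - t₀) w`. Regularity therefore confines the `x ∈ 𝒩`
with `(J - R)ᵀ x = 0` to the second state component, on which `G₂ᵀ` is injective by full row rank.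
Hence `Gᵀ` is injective on these `x`.

Under the constant rank assumptions the kernels of the staircase reduction have constant dimension,
so that the orthogonal projections onto them are `C¹`. They combine to six orthogonal projections of
the state space and three of the input space, which account for all zeros and invertible blocks. For
a `C¹` orthogonal projection `P`, the flow of `[Ṗ, P]` is orthogonal and carries the range of `P`
along, which gives `C¹` orthonormal frames; these are the block columns of `V` and `U`.

The change of variables turns `J` into `Vᵀ J V`, which lacks the zeros to the right of the first two
block columns when `J` is not skew-symmetric, and `Vᵀ V̇` fills `K̂`. Since only `Ê K̂ - Ĵ` and `R̂`
matter, `K̂` may be compressed to the first two state blocks, on which `Ê` acts, and `Ĵ` adjusted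
accordingly; skew-adjointness then turns the zeros below the diagonal into those to the right of it.
-/

section Calculus

variable {l m n : Type} {T : Set ℝ} {t : ℝ}

namespace MatC1On

variable {M N : ℝ → Matrix m n ℝ}

theorem add (hM : MatC1On M T) (hN : MatC1On N T) : MatC1On (fun t => M t + N t) T :=
  fun i j => (hM i j).add (hN i j)

theorem sub (hM : MatC1On M T) (hN : MatC1On N T) : MatC1On (fun t => M t - N t) T :=
  fun i j => (hM i j).sub (hN i j)

theorem transpose (hM : MatC1On M T) : MatC1On (fun t => (M t)ᵀ) T :=
  fun i j => hM j i

theorem const (M : Matrix m n ℝ) (T : Set ℝ) : MatC1On (fun _ => M) T :=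
  fun _ _ => contDiffOn_const

theorem fromRows {N : ℝ → Matrix l n ℝ} (hM : MatC1On M T) (hN : MatC1On N T) :
    MatC1On (fun t => Matrix.fromRows (M t) (N t)) T :=
  Sum.rec hM hN

theorem fromBlocks_zero (hM : MatC1On M T) (m' n' : Type) :
    MatC1On (fun t => fromBlocks (M t) 0 0 (0 : Matrix m' n' ℝ)) T := by
  rintro (i | _) (j | _)
  exacts [hM i j, contDiffOn_const, contDiffOn_const, contDiffOn_const]

theorem mul [Fintype m] {M : ℝ → Matrix l m ℝ} {N : ℝ → Matrix m n ℝ}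
    (hM : MatC1On M T) (hN : MatC1On N T) : MatC1On (fun t => M t * N t) T := by
  intro i j
  simp only [Matrix.mul_apply]
  exact ContDiffOn.sum fun k _ => (hM i k).mul (hN k j)

theorem pow [Fintype n] [DecidableEq n] {M : ℝ → Matrix n n ℝ} (hM : MatC1On M T) (k : ℕ) :
    MatC1On (fun t => M t ^ k) T := by
  induction k with
  | zero => simpa only [pow_zero] using const 1 T
  | succ k ih => simpa only [pow_succ] using ih.mul hM

theorem mulVec [Fintype n] [Fintype m] {z : ℝ → n → ℝ} (hM : MatC1On M T)
    (hz : ContDiffOn ℝ 1 z T) : ContDiffOn ℝ 1 (fun t => M t *ᵥ z t) T := by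
  refine contDiffOn_pi.2 fun i => ?_
  simp only [Matrix.mulVec, dotProduct]
  exact ContDiffOn.sum fun k _ => (hM i k).mul (contDiffOn_pi.1 hz k)

theorem continuousOn (hM : MatC1On M T) : ContinuousOn M T :=
  continuousOn_pi.2 fun i => continuousOn_pi.2 fun j => (hM i j).continuousOn

theorem continuousOn_matDeriv (hM : MatC1On M T) (hT : UniqueDiffOn ℝ T) :
    ContinuousOn (matDeriv M T) T :=
  continuousOn_pi.2 fun i => continuousOn_pi.2 fun j =>
    (hM i j).continuousOn_derivWithin hT le_rfl

theorem differentiableWithinAt (hM : MatC1On M T) (ht : t ∈ T) (i : m) (j : n) :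
    DifferentiableWithinAt ℝ (fun s => M s i j) T t :=
  (hM i j).differentiableOn one_ne_zero t ht

theorem eq_left_of_matDeriv_eq_zero {a b : ℝ} (hM : MatC1On M (Set.Icc a b))
    (h : ∀ t ∈ Set.Icc a b, matDeriv M (Set.Icc a b) t = 0) (ht : t ∈ Set.Icc a b) :
    M t = M a := by
  ext i j
  exact constant_of_derivWithin_zero ((hM i j).differentiableOn one_ne_zero)
    (fun s hs => congrFun₂ (h s (Set.Ico_subset_Icc_self hs)) i j) t ht

end MatC1On

theorem continuousOn_matrix_mul [Fintype m] {M : ℝ → Matrix l m ℝ} {N : ℝ → Matrix m n ℝ}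
    (hM : ContinuousOn M T) (hN : ContinuousOn N T) : ContinuousOn (fun t => M t * N t) T :=
  (continuous_fst.matrix_mul continuous_snd).comp_continuousOn (hM.prodMk hN)

theorem matDeriv_transpose (M : ℝ → Matrix m n ℝ) (T : Set ℝ) (t : ℝ) :
    matDeriv (fun t => (M t)ᵀ) T t = (matDeriv M T t)ᵀ := rfl

theorem matDeriv_const (M : Matrix m n ℝ) (T : Set ℝ) (t : ℝ) :
    matDeriv (fun _ => M) T t = 0 := by
  ext i j
  simp [matDeriv]

theorem matDeriv_congr {M N : ℝ → Matrix m n ℝ} (h : Set.EqOn M N T) (ht : t ∈ T) :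
    matDeriv M T t = matDeriv N T t := by
  ext i j
  exact derivWithin_congr (fun s hs => congrFun₂ (h hs) i j) (congrFun₂ (h ht) i j)

theorem matDeriv_mul [Fintype m] {M : ℝ → Matrix l m ℝ} {N : ℝ → Matrix m n ℝ}
    (hM : MatC1On M T) (hN : MatC1On N T) (ht : t ∈ T) :
    matDeriv (fun t => M t * N t) T t = matDeriv M T t * N t + M t * matDeriv N T t := by
  have hM := hM.differentiableWithinAt ht
  have hN := hN.differentiableWithinAt ht
  ext i j
  simp only [matDeriv, of_apply, Matrix.add_apply, Matrix.mul_apply, ← Finset.sum_add_distrib]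
  rw [derivWithin_fun_sum fun k _ => (hM i k).fun_mul (hN k j)]
  exact Finset.sum_congr rfl fun k _ => derivWithin_fun_mul (hM i k) (hN k j)

theorem derivWithin_mulVec [Fintype n] [Finite m] {M : ℝ → Matrix m n ℝ} {z : ℝ → n → ℝ}
    (hM : MatC1On M T) (hz : ContDiffOn ℝ 1 z T) (ht : t ∈ T) :
    derivWithin (fun t => M t *ᵥ z t) T t = matDeriv M T t *ᵥ z t + M t *ᵥ derivWithin z T t := by
  cases nonempty_fintype m
  have hMz := differentiableWithinAt_pi.1 ((hM.mulVec hz).differentiableOn one_ne_zero t ht)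
  have hM := hM.differentiableWithinAt ht
  have hz k := (contDiffOn_pi.1 hz k).differentiableOn one_ne_zero t ht
  ext i
  rw [derivWithin_pi hMz, derivWithin_pi hz]
  simp only [Matrix.mulVec, dotProduct, Pi.add_apply, matDeriv, of_apply, ← Finset.sum_add_distrib]
  rw [derivWithin_fun_sum fun k _ => (hM i k).fun_mul (hz k)]
  exact Finset.sum_congr rfl fun k _ => derivWithin_fun_mul (hM i k) (hz k)

theorem matDeriv_eq_of_hasDerivWithinAt {M M' : ℝ → Matrix m n ℝ} (hT : UniqueDiffOn ℝ T)
    (hM : ∀ i j, ∀ t ∈ T, HasDerivWithinAt (fun s => M s i j) (M' t i j) T t) (ht : t ∈ T) :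
    matDeriv M T t = M' t := by
  ext i j
  exact (hM i j t ht).derivWithin (hT t ht)

theorem matC1On_of_hasDerivWithinAt {M M' : ℝ → Matrix m n ℝ} (hT : UniqueDiffOn ℝ T)
    (hM : ∀ i j, ∀ t ∈ T, HasDerivWithinAt (fun s => M s i j) (M' t i j) T t)
    (hM' : ContinuousOn M' T) : MatC1On M T := by
  intro i j
  rw [contDiffOn_one_iff_derivWithin hT]
  exact ⟨fun t ht => (hM i j t ht).differentiableWithinAt,
    (continuousOn_pi.1 (continuousOn_pi.1 hM' i) j).congr fun t ht =>
      (hM i j t ht).derivWithin (hT t ht)⟩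

end Calculus

section Flow

open scoped InnerProductSpace

variable {H : Type*} [NormedAddCommGroup H] [InnerProductSpace ℝ H] {a b : ℝ}

theorem exists_contDiff_bounded_smul (r : ℝ) :
    ∃ (c : ℝ) (φ : H → ℝ), ContDiff ℝ 1 φ ∧ (∀ x, ‖φ x • x‖ ≤ c) ∧ ∀ x, ‖x‖ = r → φ x = 1 := by
  have hpos (x : H) : 0 < 1 + ‖x‖ ^ 2 := by positivity
  have hc : 0 < 1 + r ^ 2 := by positivity
  refine ⟨1 + r ^ 2, fun x => (1 + r ^ 2) / (1 + ‖x‖ ^ 2), ?_, fun x => ?_, ?_⟩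
  · exact contDiff_const.div (contDiff_const.add (contDiff_norm_sq ℝ)) fun x => (hpos x).ne'
  · rw [norm_smul, Real.norm_of_nonneg (by positivity), div_mul_eq_mul_div, div_le_iff₀ (hpos x)]
    gcongr
    nlinarith [sq_nonneg (‖x‖ - 1), norm_nonneg x]
  · rintro x rfl
    exact div_self hc.ne'

variable [FiniteDimensional ℝ H] {B : ℝ → H →L[ℝ] H}

theorem exists_solution_of_bounded (hab : a ≤ b) (hB : ContinuousOn B (Set.Icc a b)) {f : H → H}
    (hf : ContDiff ℝ 1 f) {c : ℝ} (hc : ∀ x, ‖f x‖ ≤ c) (x₀ : H) :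
    ∃ x : ℝ → H, x a = x₀ ∧
      ∀ t ∈ Set.Icc a b, HasDerivWithinAt x (B t (f (x t))) (Set.Icc a b) t := by
  have : ProperSpace H := FiniteDimensional.proper ℝ H
  have : CompleteSpace H := FiniteDimensional.complete ℝ H
  obtain ⟨C, hC⟩ := isCompact_Icc.exists_bound_of_continuousOn hB
  have hC0 : 0 ≤ C := (norm_nonneg _).trans (hC a (Set.left_mem_Icc.2 hab))
  have hc0 : 0 ≤ c := (norm_nonneg _).trans (hc 0)
  have hr : 0 ≤ C * c * (b - a) := mul_nonneg (mul_nonneg hC0 hc0) (sub_nonneg.2 hab)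
  obtain ⟨L, hL⟩ := LocallyLipschitzOn.exists_lipschitzOnWith_of_compact
    (isCompact_closedBall x₀ (C * c * (b - a))) hf.locallyLipschitz.locallyLipschitzOn
  have hPL : IsPicardLindelof (fun t x => B t (f x)) ⟨a, Set.left_mem_Icc.2 hab⟩ x₀
      ⟨C * c * (b - a), hr⟩ 0 ⟨C * c, mul_nonneg hC0 hc0⟩ (⟨C, hC0⟩ * L) := by
    refine ⟨fun t ht => ?_, fun x _ => hB.clm_apply continuousOn_const, fun t ht x _ => ?_, ?_⟩
    · exact ((B t).lipschitz.weaken (by exact_mod_cast hC t ht)).comp_lipschitzOnWith hL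
    · exact ((B t).le_opNorm _).trans (mul_le_mul (hC t ht) (hc x) (norm_nonneg _) hC0)
    · simp only [NNReal.coe_zero, sub_zero, sub_self, max_eq_left (sub_nonneg.2 hab)]
      exact le_rfl
  exact hPL.exists_eq_forall_mem_Icc_hasDerivWithinAt₀

-- A skew coefficient preserves norms, also after truncating the right-hand side to a bounded one;
-- hence the truncation is never felt by the solution.
theorem exists_solution_of_skew (hab : a ≤ b) (hB : ContinuousOn B (Set.Icc a b))
    (hskew : ∀ t ∈ Set.Icc a b, ∀ x, ⟪x, B t x⟫_ℝ = 0) (x₀ : H) :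
    ∃ x : ℝ → H, x a = x₀ ∧
      ∀ t ∈ Set.Icc a b, HasDerivWithinAt x (B t (x t)) (Set.Icc a b) t := by
  obtain ⟨c, φ, hφ, hc, hφ_one⟩ := exists_contDiff_bounded_smul (H := H) ‖x₀‖
  obtain ⟨x, hx₀, hx⟩ := exists_solution_of_bounded hab hB (f := fun x => φ x • x)
    (hφ.smul contDiff_id) hc x₀
  have hnorm_deriv : ∀ t ∈ Set.Icc a b,
      HasDerivWithinAt (fun t => ‖x t‖ ^ 2) 0 (Set.Icc a b) t := by
    intro t ht
    convert (hx t ht).norm_sq using 1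
    simp only [map_smul, inner_smul_right, hskew t ht, mul_zero]
  have hnorm : ∀ t ∈ Set.Icc a b, ‖x t‖ = ‖x₀‖ := by
    intro t ht
    have hsq : ‖x t‖ ^ 2 = ‖x a‖ ^ 2 := constant_of_has_deriv_right_zero
      (fun s hs => (hnorm_deriv s hs).continuousWithinAt)
      (fun s hs => (hnorm_deriv s (Set.Ico_subset_Icc_self hs)).mono_of_mem_nhdsWithin
        (Icc_mem_nhdsGE_of_mem hs)) t ht
    rwa [hx₀, sq_eq_sq₀ (norm_nonneg _) (norm_nonneg _)] at hsq
  refine ⟨x, hx₀, fun t ht => ?_⟩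
  simpa only [hφ_one _ (hnorm t ht), one_smul] using hx t ht

variable {n : Type} [Fintype n]

theorem dotProduct_mulVec_self_eq_zero_of_skew {B : Matrix n n ℝ} (hB : Bᵀ = -B) (x : n → ℝ) :
    x ⬝ᵥ (B *ᵥ x) = 0 := by
  have h : x ⬝ᵥ (B *ᵥ x) = -(x ⬝ᵥ (B *ᵥ x)) := by
    conv_lhs => rw [dotProduct_mulVec, ← mulVec_transpose, hB, neg_mulVec, neg_dotProduct,
      dotProduct_comm]
  linarith

variable [DecidableEq n]

theorem exists_fundamentalMatrix_of_skew (hab : a ≤ b) {B : ℝ → Matrix n n ℝ}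
    (hB : ContinuousOn B (Set.Icc a b)) (hskew : ∀ t ∈ Set.Icc a b, (B t)ᵀ = -B t) :
    ∃ W : ℝ → Matrix n n ℝ, W a = 1 ∧ ∀ i j, ∀ t ∈ Set.Icc a b,
      HasDerivWithinAt (fun s => W s i j) ((B t * W t) i j) (Set.Icc a b) t := by
  let L : Matrix n n ℝ →ₗ[ℝ] (EuclideanSpace ℝ n →L[ℝ] EuclideanSpace ℝ n) :=
    LinearMap.toContinuousLinearMap.toLinearMap ∘ₗ
      (Matrix.toEuclideanLin (𝕜 := ℝ) (m := n) (n := n)).toLinearMap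
  have hL : ContinuousOn (fun t => L (B t)) (Set.Icc a b) :=
    (LinearMap.continuous_of_finiteDimensional L).comp_continuousOn hB
  have hLskew : ∀ t ∈ Set.Icc a b, ∀ x, ⟪x, L (B t) x⟫_ℝ = 0 := fun t ht x =>
    (dotProduct_comm _ _).trans (dotProduct_mulVec_self_eq_zero_of_skew (hskew t ht) x.ofLp)
  choose x hx₀ hx using fun j : n =>
    exists_solution_of_skew hab hL hLskew (EuclideanSpace.single j (1 : ℝ))
  refine ⟨fun t => Matrix.of fun i j => x j t i, ?_, fun i j t ht => ?_⟩
  · ext i j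
    simp [hx₀, Matrix.one_apply]
  · exact (EuclideanSpace.proj (𝕜 := ℝ) i).hasFDerivAt.comp_hasDerivWithinAt t (hx j t ht)

theorem exists_orthogonal_flow (hab : a < b) {B : ℝ → Matrix n n ℝ}
    (hB : ContinuousOn B (Set.Icc a b)) (hskew : ∀ t ∈ Set.Icc a b, (B t)ᵀ = -B t) :
    ∃ W : ℝ → Matrix n n ℝ, MatC1On W (Set.Icc a b) ∧ IsOrthogonalOn W (Set.Icc a b) ∧ W a = 1 ∧
      ∀ t ∈ Set.Icc a b, matDeriv W (Set.Icc a b) t = B t * W t := by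
  have hT := uniqueDiffOn_Icc hab
  obtain ⟨W, hWa, hW'⟩ := exists_fundamentalMatrix_of_skew hab.le hB hskew
  have hWcont : ContinuousOn W (Set.Icc a b) := continuousOn_pi.2 fun i =>
    continuousOn_pi.2 fun j t ht => (hW' i j t ht).continuousWithinAt
  have hW := matC1On_of_hasDerivWithinAt hT hW' (continuousOn_matrix_mul hB hWcont)
  have hWderiv := fun t ht => matDeriv_eq_of_hasDerivWithinAt hT hW' (t := t) ht
  refine ⟨W, hW, fun t ht => ?_, hWa, hWderiv⟩
  have hWW : (W t)ᵀ * W t = 1 := by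
    refine ((hW.transpose.mul hW).eq_left_of_matDeriv_eq_zero (fun s hs => ?_) ht).trans
      (by simp [hWa])
    rw [matDeriv_mul hW.transpose hW hs, matDeriv_transpose, hWderiv s hs, transpose_mul,
      hskew s hs]
    simp [mul_assoc]
  exact ⟨hWW, mul_eq_one_comm.1 hWW⟩

end Flow

section OrthogonalProjections

/-- `P` is the matrix of the orthogonal projection onto the subspace `S` of `ℝⁿ`. -/
structure IsOrthProj {n : Type} [Fintype n] (P : Matrix n n ℝ) (S : Submodule ℝ (n → ℝ)) :
    Prop where
  isStarProjection : IsStarProjection P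
  range_eq : LinearMap.range P.mulVecLin = S

variable {l m n : Type} [Fintype n] {P P' L : Matrix n n ℝ} {S S' : Submodule ℝ (n → ℝ)}
  {M : Matrix m n ℝ} {x : n → ℝ}

theorem transpose_eq_of_isStarProjection (hP : IsStarProjection P) : Pᵀ = P := by
  simpa only [star_eq_conjTranspose, conjTranspose_eq_transpose_of_trivial] using
    hP.isSelfAdjoint.star_eq

namespace IsOrthProj

theorem transpose_eq (hP : IsOrthProj P S) : Pᵀ = P :=
  transpose_eq_of_isStarProjection hP.isStarProjection

theorem mul_self (hP : IsOrthProj P S) : P * P = P :=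
  hP.isStarProjection.isIdempotentElem

theorem mulVec_mem (hP : IsOrthProj P S) (x : n → ℝ) : P *ᵥ x ∈ S :=
  hP.range_eq ▸ LinearMap.mem_range_self P.mulVecLin x

theorem mulVec_eq_iff (hP : IsOrthProj P S) : P *ᵥ x = x ↔ x ∈ S := by
  refine ⟨fun hx => hx ▸ hP.mulVec_mem x, fun hx => ?_⟩
  obtain ⟨y, rfl⟩ := hP.range_eq ▸ hx
  rw [mulVecLin_apply, mulVec_mulVec, hP.mul_self]

theorem of_mulVec (hT : Pᵀ = P) (hmem : ∀ x, P *ᵥ x ∈ S) (hfix : ∀ x ∈ S, P *ᵥ x = x) :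
    IsOrthProj P S where
  isStarProjection :=
    { isIdempotentElem := mulVec_injective <| funext fun x => by
        rw [← mulVec_mulVec, hfix _ (hmem _)]
      isSelfAdjoint := by
        rw [IsSelfAdjoint, star_eq_conjTranspose, conjTranspose_eq_transpose_of_trivial, hT] }
  range_eq := le_antisymm (LinearMap.range_le_iff_comap.2 (eq_top_iff.2 fun x _ => hmem x))
    fun x hx => ⟨x, hfix x hx⟩

theorem rank_eq (hP : IsOrthProj P S) : P.rank = Module.finrank ℝ S := by
  rw [Matrix.rank, hP.range_eq]

theorem rank_mul (hP : IsOrthProj P S) (M : Matrix m n ℝ) :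
    (M * P).rank = Module.finrank ℝ (S.map M.mulVecLin) := by
  rw [Matrix.rank, mulVecLin_mul, LinearMap.range_comp, hP.range_eq]

theorem mul_eq_right_of_le (hP : IsOrthProj P S) (hP' : IsOrthProj P' S') (h : S ≤ S') :
    P' * P = P :=
  mulVec_injective <| funext fun x => by
    rw [← mulVec_mulVec, hP'.mulVec_eq_iff.2 (h (hP.mulVec_mem _))]

theorem mul_eq_left_of_le (hP : IsOrthProj P S) (hP' : IsOrthProj P' S') (h : S ≤ S') :
    P * P' = P := by
  simpa only [transpose_mul, hP.transpose_eq, hP'.transpose_eq] using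
    congrArg Matrix.transpose (hP.mul_eq_right_of_le hP' h)

theorem mul_eq_zero (hP : IsOrthProj P (LinearMap.ker M.mulVecLin)) : M * P = 0 :=
  mulVec_injective <| funext fun x => by
    rw [← mulVec_mulVec, zero_mulVec]
    exact hP.mulVec_mem _

theorem mul_transpose_eq_zero (hP : IsOrthProj P (LinearMap.ker M.mulVecLin)) : P * Mᵀ = 0 := by
  rw [← hP.transpose_eq, ← transpose_mul, hP.mul_eq_zero, transpose_zero]

theorem mul_eq_right (hP : IsOrthProj P (LinearMap.ker M.mulVecLin)) {X : Matrix n l ℝ}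
    (hX : M * X = 0) : P * X = X := by
  ext i j
  have hcol : M *ᵥ X.col j = 0 := funext fun k => congrFun₂ hX k j
  exact congrFun (hP.mulVec_eq_iff.2 hcol) i

theorem inf_ker (hP : IsOrthProj P S) (hL : IsOrthProj L (LinearMap.ker (M * P).mulVecLin)) :
    IsOrthProj (P * L) (S ⊓ LinearMap.ker M.mulVecLin) := by
  classical
  have hLP : L * (1 - P) = 1 - P := hL.mul_eq_right (by
    rw [Matrix.mul_sub, Matrix.mul_one, Matrix.mul_assoc, hP.mul_self, sub_self])
  have hcomm : L * P = P * L := by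
    have hLP_eq : L * P = L + P - 1 := by
      rw [mul_sub, mul_one] at hLP
      rw [← sub_sub_cancel L (L * P), hLP]
      abel
    have h := congrArg Matrix.transpose hLP_eq
    simp only [transpose_mul, transpose_sub, transpose_add, transpose_one, hP.transpose_eq,
      hL.transpose_eq] at h
    rw [hLP_eq, h]
  refine .of_mulVec ?_ (fun x => ?_) fun x hx => ?_
  · rw [transpose_mul, hP.transpose_eq, hL.transpose_eq, hcomm]
  · refine ⟨mulVec_mulVec x P L ▸ hP.mulVec_mem _, ?_⟩
    rw [SetLike.mem_coe, LinearMap.mem_ker, mulVecLin_apply, mulVec_mulVec, ← Matrix.mul_assoc,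
      hL.mul_eq_zero, zero_mulVec]
  · obtain ⟨hxS, hxM : M *ᵥ x = 0⟩ := hx
    have hPx := hP.mulVec_eq_iff.2 hxS
    rw [← mulVec_mulVec, hL.mulVec_eq_iff.2, hPx]
    rw [LinearMap.mem_ker, mulVecLin_apply, ← mulVec_mulVec, hPx, hxM]

end IsOrthProj

end OrthogonalProjections

section KernelProjection

open Polynomial

variable {m n : Type} [Fintype n] [DecidableEq n]

theorem exists_charpoly_eq_X_pow_mul {S : Matrix n n ℝ} (hS : S.IsHermitian) :
    ∃ q : ℝ[X], S.charpoly = X ^ (Fintype.card n - S.rank) * q ∧ q.coeff 0 ≠ 0 := by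
  refine ⟨∏ i with hS.eigenvalues i ≠ 0, (X - C (hS.eigenvalues i)), ?_, ?_⟩
  · have hcard : Fintype.card n - S.rank =
        (Finset.univ.filter fun i => hS.eigenvalues i = 0).card := by
      rw [hS.rank_eq_card_non_zero_eigs, Fintype.card_subtype, ← Finset.card_univ,
        ← Finset.card_filter_add_card_filter_not (s := Finset.univ)
          (fun i => hS.eigenvalues i = 0), Nat.add_sub_cancel]
    rw [hS.charpoly_eq, hcard, ← Finset.prod_const,
      ← Finset.prod_filter_mul_prod_filter_not Finset.univ (fun i => hS.eigenvalues i = 0)]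
    congr 1
    exact Finset.prod_congr rfl fun i hi => by simp [(Finset.mem_filter.1 hi).2]
  · rw [coeff_zero_eq_eval_zero, eval_prod, Finset.prod_ne_zero_iff]
    intro i hi
    simpa using (Finset.mem_filter.1 hi).2

theorem mul_eq_zero_of_pow_mul_eq_zero {S X : Matrix n n ℝ} (hS : Sᵀ = S) {k : ℕ}
    (h : S ^ k * X = 0) : S * X = 0 := by
  induction k with
  | zero => rw [← one_mul X, ← pow_zero S, h, mul_zero]
  | succ k ih =>
    rcases k with _ | k
    · simpa only [zero_add, pow_one] using h
    · refine ih (mulVec_injective <| funext fun x => ?_)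
      have hker : (S ^ k * X) *ᵥ x ∈ LinearMap.ker (Sᵀ * S).mulVecLin := by
        rw [LinearMap.mem_ker, mulVecLin_apply, mulVec_mulVec, hS, ← mul_assoc, mul_assoc S,
          ← pow_succ', ← pow_succ', h, zero_mulVec]
      rw [ker_mulVecLin_transpose_mul_self, LinearMap.mem_ker, mulVecLin_apply,
        mulVec_mulVec] at hker
      rwa [pow_succ', mul_assoc, zero_mulVec]

theorem transpose_aeval (S : Matrix n n ℝ) (q : ℝ[X]) : (aeval S q)ᵀ = aeval Sᵀ q := by
  simp only [aeval_eq_sum_range, transpose_sum, transpose_smul, transpose_pow]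

theorem isOrthProj_ker_of_charpoly_eq {S : Matrix n n ℝ} (hS : Sᵀ = S) {k : ℕ} {q : ℝ[X]}
    (hq : S.charpoly = X ^ k * q) (hq₀ : q.coeff 0 ≠ 0) :
    IsOrthProj ((q.coeff 0)⁻¹ • aeval S q) (LinearMap.ker S.mulVecLin) := by
  refine .of_mulVec ?_ (fun x => ?_) fun x (hx : S *ᵥ x = 0) => ?_
  · rw [transpose_smul, transpose_aeval, hS]
  · have hpow : S ^ k * aeval S q = 0 := by
      rw [← Matrix.aeval_self_charpoly S, hq, map_mul, map_pow, aeval_X]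
    rw [LinearMap.mem_ker, mulVecLin_apply, mulVec_mulVec, mul_smul_comm,
      mul_eq_zero_of_pow_mul_eq_zero hS hpow, smul_zero, zero_mulVec]
  · have haeval : aeval S q *ᵥ x = q.coeff 0 • x := by
      rw [← divX_mul_X_add q, map_add, map_mul, aeval_X, aeval_C, add_mulVec, ← mulVec_mulVec, hx,
        mulVec_zero, zero_add, Algebra.algebraMap_eq_smul_one, smul_mulVec, one_mulVec,
        divX_mul_X_add]
    rw [smul_mulVec, haeval, smul_smul, inv_mul_cancel₀ hq₀, one_smul]

theorem isOrthProj_ker_of_charpoly_coeff [Fintype m] (M : Matrix m n ℝ) {k : ℕ}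
    (hk : Fintype.card n - M.rank = k) :
    (Mᵀ * M).charpoly.coeff k ≠ 0 ∧
    IsOrthProj (((Mᵀ * M).charpoly.coeff k)⁻¹ • ∑ j ∈ Finset.range (Fintype.card n + 1),
      (Mᵀ * M).charpoly.coeff (j + k) • (Mᵀ * M) ^ j) (LinearMap.ker M.mulVecLin) := by
  have hT : (Mᵀ * M)ᵀ = Mᵀ * M := by rw [transpose_mul, transpose_transpose]
  obtain ⟨q, hq, hq₀⟩ := exists_charpoly_eq_X_pow_mul
    (show (Mᵀ * M).IsHermitian by rw [IsHermitian, conjTranspose_eq_transpose_of_trivial, hT])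
  rw [rank_transpose_mul_self, hk] at hq
  have hdeg : q.natDegree < Fintype.card n + 1 := by
    have h := congrArg natDegree hq
    rw [charpoly_natDegree_eq_dim, natDegree_mul (pow_ne_zero _ X_ne_zero)
      (by rintro rfl; simp at hq₀)] at h
    omega
  have hcoeff (j : ℕ) : (Mᵀ * M).charpoly.coeff (j + k) = q.coeff j := by
    rw [hq, coeff_X_pow_mul]
  have hcoeff₀ : (Mᵀ * M).charpoly.coeff k = q.coeff 0 := by simpa only [zero_add] using hcoeff 0
  simp only [hcoeff, hcoeff₀, ← aeval_eq_sum_range' hdeg, ← ker_mulVecLin_transpose_mul_self M]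
  exact ⟨hq₀, isOrthProj_ker_of_charpoly_eq hT hq hq₀⟩

theorem MatC1On.contDiffOn_charpoly_coeff {M : ℝ → Matrix n n ℝ} {T : Set ℝ} (hM : MatC1On M T)
    (k : ℕ) : ContDiffOn ℝ 1 (fun t => (M t).charpoly.coeff k) T := by
  have heval (p : MvPolynomial (n × n) ℝ) :
      ContDiffOn ℝ 1 (fun t => MvPolynomial.eval (fun ij => M t ij.1 ij.2) p) T := by
    induction p using MvPolynomial.induction_on with
    | C a => simpa only [MvPolynomial.eval_C] using contDiffOn_const
    | add p q hp hq => simpa only [map_add] using hp.add hq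
    | mul_X p i hp => simpa only [map_mul, MvPolynomial.eval_X] using hp.mul (hM i.1 i.2)
  exact (heval ((charpoly.univ ℝ n).coeff k)).congr fun t _ =>
    (charpoly.univ_coeff_eval₂Hom n (RingHom.id ℝ) (fun ij => M t ij.1 ij.2) k).symm

end KernelProjection

section ConstantRank

variable {m n : Type} [Finite m] [Fintype n]

theorem MatC1On.exists_isOrthProj_ker {M : ℝ → Matrix m n ℝ} {T : Set ℝ}
    (hM : MatC1On M T) {r : ℕ} (hr : ∀ t ∈ T, (M t).rank = r) :
    ∃ P : ℝ → Matrix n n ℝ, MatC1On P T ∧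
      ∀ t ∈ T, IsOrthProj (P t) (LinearMap.ker (M t).mulVecLin) := by
  classical
  cases nonempty_fintype m
  have hS : MatC1On (fun t => (M t)ᵀ * M t) T := hM.transpose.mul hM
  have hP t ht := isOrthProj_ker_of_charpoly_coeff (M t) (congrArg (Fintype.card n - ·) (hr t ht))
  refine ⟨_, fun i j => ?_, fun t ht => (hP t ht).2⟩
  simp only [Matrix.smul_apply, Matrix.sum_apply, smul_eq_mul]
  refine ((hS.contDiffOn_charpoly_coeff _).inv fun t ht => (hP t ht).1).mul ?_
  exact ContDiffOn.sum fun l _ => (hS.contDiffOn_charpoly_coeff _).mul (hS.pow l i j)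

theorem MatC1On.exists_isOrthProj_inf_ker {M : ℝ → Matrix m n ℝ}
    {P : ℝ → Matrix n n ℝ} {S : ℝ → Submodule ℝ (n → ℝ)} {T : Set ℝ} (hM : MatC1On M T)
    (hP : MatC1On P T) (hPS : ∀ t ∈ T, IsOrthProj (P t) (S t)) {r : ℕ}
    (hr : ∀ t ∈ T, Module.finrank ℝ ((S t).map (M t).mulVecLin) = r) :
    ∃ P' : ℝ → Matrix n n ℝ, MatC1On P' T ∧
      ∀ t ∈ T, IsOrthProj (P' t) (S t ⊓ LinearMap.ker (M t).mulVecLin) := by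
  obtain ⟨L, hL, hLker⟩ := (hM.mul hP).exists_isOrthProj_ker fun t ht =>
    ((hPS t ht).rank_mul (M t)).trans (hr t ht)
  exact ⟨fun t => P t * L t, hP.mul hL, fun t ht => (hPS t ht).inf_ker (hLker t ht)⟩

end ConstantRank

section Frames

variable {n d : Type} [Fintype n]

/-- The columns of `F` form an orthonormal basis of the range of the orthogonal projection `P`. -/
structure IsFrame [Fintype d] [DecidableEq d] (F : Matrix n d ℝ) (P : Matrix n n ℝ) : Prop where
  transpose_mul_self : Fᵀ * F = 1
  mul_transpose_self : F * Fᵀ = P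

namespace IsFrame

variable [Fintype d] [DecidableEq d] {F : Matrix n d ℝ} {P : Matrix n n ℝ}

theorem mul_eq (hF : IsFrame F P) : P * F = F := by
  rw [← hF.mul_transpose_self, Matrix.mul_assoc, hF.transpose_mul_self, Matrix.mul_one]

theorem transpose_mul_eq (hF : IsFrame F P) : Fᵀ * P = Fᵀ := by
  rw [← hF.mul_transpose_self, ← Matrix.mul_assoc, hF.transpose_mul_self, Matrix.one_mul]

theorem rank_eq (hF : IsFrame F P) : P.rank = Fintype.card d := by
  rw [← hF.mul_transpose_self, rank_self_mul_transpose, ← rank_transpose_mul_self,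
    hF.transpose_mul_self, rank_one]

end IsFrame

theorem exists_isFrame {P : Matrix n n ℝ} (hP : IsStarProjection P) :
    ∃ (d : ℕ) (F : Matrix n (Fin d) ℝ), IsFrame F P := by
  classical
  have hH : P.IsHermitian := hP.isSelfAdjoint
  have heig (i : n) : hH.eigenvalues i = 0 ∨ hH.eigenvalues i = 1 :=
    hP.isIdempotentElem.spectrum_subset ℝ (hH.eigenvalues_mem_spectrum_real i)
  let e := (Fintype.equivFin {i // hH.eigenvalues i ≠ 0}).symm
  let U : Matrix n n ℝ := hH.eigenvectorUnitary
  have hUU : Uᵀ * U = 1 := by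
    simpa only [star_eq_conjTranspose, conjTranspose_eq_transpose_of_trivial] using
      Unitary.coe_star_mul_self hH.eigenvectorUnitary
  have hPU : P = U * diagonal hH.eigenvalues * Uᵀ := by
    simpa [Unitary.conjStarAlgAut_apply, star_eq_conjTranspose,
      conjTranspose_eq_transpose_of_trivial] using hH.spectral_theorem
  refine ⟨_, U.submatrix id (fun k => (e k : n)), ?_, ?_⟩
  · rw [transpose_submatrix, ← submatrix_mul _ _ _ _ _ Function.bijective_id, hUU,
      submatrix_one (fun k => (e k : n)) (Subtype.val_injective.comp e.injective)]
  · ext i j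
    have hPij : P i j = ∑ k, U i k * hH.eigenvalues k * U j k := by
      simpa only [mul_diagonal, transpose_apply] using
        (congrFun₂ hPU i j).trans (Matrix.mul_apply ..)
    rw [hPij, Matrix.mul_apply]
    simp only [submatrix_apply, transpose_apply, id]
    rw [e.sum_comp fun k : {i // hH.eigenvalues i ≠ 0} => U i k * U j k,
      ← Finset.sum_subtype (Finset.univ.filter fun k => hH.eigenvalues k ≠ 0) (by simp)
        fun k => U i k * U j k, Finset.sum_filter]
    refine Finset.sum_congr rfl fun k _ => ?_
    rcases heig k with hk | hk <;> simp [hk]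

theorem kato_commutator_identity {A : Type*} [Ring A] {p q : A} (hp : p * p = p)
    (hq : q * p + p * q = q) : (p * q - q * p) * p + q + p * (q * p - p * q) = 0 := by
  have hpqp : p * q * p = 0 := by
    have h := congrArg (p * · * p) hq
    simp only [mul_add, add_mul] at h
    rw [← mul_assoc p p, hp, mul_assoc p _ p, mul_assoc q, hp, ← mul_assoc] at h
    simpa using h
  rw [sub_mul, mul_sub, hpqp, ← mul_assoc p, hpqp, mul_assoc q, ← mul_assoc p p, hp]
  nth_rewrite 2 [← hq]
  abel

variable {a b : ℝ} {P : ℝ → Matrix n n ℝ}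

-- The flow of the commutator `[Ṗ, P]` transports the ranges of `P` (T. Kato).
theorem MatC1On.exists_orthogonal_conj [DecidableEq n] (hab : a < b)
    (hP : MatC1On P (Set.Icc a b)) (hproj : ∀ t ∈ Set.Icc a b, IsStarProjection (P t)) :
    ∃ W : ℝ → Matrix n n ℝ, MatC1On W (Set.Icc a b) ∧ IsOrthogonalOn W (Set.Icc a b) ∧
      ∀ t ∈ Set.Icc a b, W t * P a * (W t)ᵀ = P t := by
  have hPT (t) (ht : t ∈ Set.Icc a b) : (P t)ᵀ = P t :=
    transpose_eq_of_isStarProjection (hproj t ht)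
  have hPP (t) (ht : t ∈ Set.Icc a b) : P t * P t = P t := (hproj t ht).isIdempotentElem
  let P' := matDeriv P (Set.Icc a b)
  have hP'cont : ContinuousOn P' (Set.Icc a b) := hP.continuousOn_matDeriv (uniqueDiffOn_Icc hab)
  have hP'T (t) (ht : t ∈ Set.Icc a b) : (P' t)ᵀ = P' t := by
    rw [← matDeriv_transpose]
    exact matDeriv_congr hPT ht
  have hPP' (t) (ht : t ∈ Set.Icc a b) : P' t * P t + P t * P' t = P' t := by
    rw [← matDeriv_mul hP hP ht]
    exact matDeriv_congr hPP ht
  obtain ⟨W, hW, hWorth, hWa, hW'⟩ := exists_orthogonal_flow hab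
    (B := fun t => P' t * P t - P t * P' t)
    ((continuousOn_matrix_mul hP'cont hP.continuousOn).sub
      (continuousOn_matrix_mul hP.continuousOn hP'cont))
    (fun t ht => by
      rw [transpose_sub, transpose_mul, transpose_mul, hPT t ht, hP'T t ht, neg_sub])
  have hconst (t) (ht : t ∈ Set.Icc a b) : (W t)ᵀ * (P t * W t) = P a := by
    refine ((hW.transpose.mul (hP.mul hW)).eq_left_of_matDeriv_eq_zero (fun s hs => ?_) ht).trans
      (by simp [hWa])
    rw [matDeriv_mul hW.transpose (hP.mul hW) hs, matDeriv_transpose, matDeriv_mul hP hW hs,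
      hW' s hs, transpose_mul, transpose_sub, transpose_mul, transpose_mul, hPT s hs, hP'T s hs]
    calc _ = (W s)ᵀ * ((P s * P' s - P' s * P s) * P s + P' s +
          P s * (P' s * P s - P s * P' s)) * W s := by
          simp only [P', mul_add, add_mul, mul_assoc]; abel
      _ = 0 := by rw [kato_commutator_identity (hPP s hs) (hPP' s hs), mul_zero, zero_mul]
  refine ⟨W, hW, hWorth, fun t ht => ?_⟩
  rw [← hconst t ht, ← mul_assoc, (hWorth t ht).2, one_mul, mul_assoc, (hWorth t ht).2, mul_one]

theorem MatC1On.exists_isFrame (hab : a < b) (hP : MatC1On P (Set.Icc a b))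
    (hproj : ∀ t ∈ Set.Icc a b, IsStarProjection (P t)) :
    ∃ (d : ℕ) (F : ℝ → Matrix n (Fin d) ℝ),
      MatC1On F (Set.Icc a b) ∧ ∀ t ∈ Set.Icc a b, IsFrame (F t) (P t) := by
  classical
  obtain ⟨d, F, hF⟩ := _root_.exists_isFrame (hproj a (Set.left_mem_Icc.2 hab.le))
  obtain ⟨W, hW, hWorth, hWP⟩ := hP.exists_orthogonal_conj hab hproj
  refine ⟨d, fun t => W t * F, hW.mul (.const F _), fun t ht => ⟨?_, ?_⟩⟩
  · rw [transpose_mul, Matrix.mul_assoc, ← Matrix.mul_assoc (W t)ᵀ, (hWorth t ht).1,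
      Matrix.one_mul, hF.transpose_mul_self]
  · rw [transpose_mul, Matrix.mul_assoc, ← Matrix.mul_assoc F, hF.mul_transpose_self,
      ← Matrix.mul_assoc, hWP t ht]

theorem MatC1On.exists_isOrthProj_ker_of_ker_transpose {m : Type} [Fintype m] (hab : a < b)
    {M : ℝ → Matrix n m ℝ} (hM : MatC1On M (Set.Icc a b)) (hP : MatC1On P (Set.Icc a b))
    (hker : ∀ t ∈ Set.Icc a b, IsOrthProj (P t) (LinearMap.ker (M t)ᵀ.mulVecLin)) :
    ∃ Q : ℝ → Matrix m m ℝ, MatC1On Q (Set.Icc a b) ∧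
      ∀ t ∈ Set.Icc a b, IsOrthProj (Q t) (LinearMap.ker (M t).mulVecLin) := by
  classical
  obtain ⟨d, F, -, hF⟩ := hP.exists_isFrame hab fun t ht => (hker t ht).isStarProjection
  refine hM.exists_isOrthProj_ker (r := Fintype.card n - d) fun t ht => ?_
  have hdim := LinearMap.finrank_range_add_finrank_ker (M t)ᵀ.mulVecLin
  rw [← (hker t ht).rank_eq, (hF t ht).rank_eq, Module.finrank_pi, Fintype.card_fin,
    ← Matrix.rank, rank_transpose] at hdim
  omega

end Frames

section KernelOfE

namespace LTVSystem

variable {n m : Type} [Fintype n] {s : LTVSystem n m} {T : Set ℝ} {t : ℝ} {x : n → ℝ}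

theorem algKernel_eq_inf_ker {P : Matrix n n ℝ}
    (hP : IsOrthProj P (LinearMap.ker (s.E t).mulVecLin)) :
    s.algKernel t =
      LinearMap.ker (s.E t).mulVecLin ⊓ LinearMap.ker (P * (s.J t - s.R t)).mulVecLin := by
  ext x
  refine and_congr_right fun _ => ⟨fun h => ?_, fun h y hy => ?_⟩
  · refine dotProduct_self_eq_zero.1 ?_
    rw [mulVecLin_apply, ← mulVec_mulVec, dotProduct_mulVec, ← mulVec_transpose, hP.transpose_eq,
      mulVec_mulVec _ P, hP.mul_self]
    exact h _ (hP.mulVec_mem _)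
  · rw [SetLike.mem_coe, LinearMap.mem_ker, mulVecLin_apply] at h
    rw [← hP.mulVec_eq_iff.2 hy, dotProduct_comm, dotProduct_mulVec, ← mulVec_transpose,
      hP.transpose_eq, mulVec_mulVec, h, zero_dotProduct]

namespace IsPHDAE

theorem R_transpose (hs : s.IsPHDAE T) (ht : t ∈ T) : (s.R t)ᵀ = s.R t := by
  rw [← conjTranspose_eq_transpose_of_trivial, (hs.R_psd t ht).isHermitian.eq]

variable {P : ℝ → Matrix n n ℝ}

theorem mul_matDeriv_E_mul_eq_zero (hs : s.IsPHDAE T) (hP : MatC1On P T)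
    (hker : ∀ t ∈ T, IsOrthProj (P t) (LinearMap.ker (s.E t).mulVecLin)) (ht : t ∈ T) :
    P t * matDeriv s.E T t * P t = 0 := by
  have hEP : matDeriv s.E T t * P t + s.E t * matDeriv P T t = 0 := by
    rw [← matDeriv_mul hs.E_C1 hP ht, matDeriv_congr (fun r hr => (hker r hr).mul_eq_zero) ht,
      matDeriv_const]
  have hPE : P t * s.E t = 0 := by
    simpa only [hs.E_symm t ht] using (hker t ht).mul_transpose_eq_zero
  rw [mul_assoc, eq_neg_of_add_eq_zero_left hEP, mul_neg, ← mul_assoc, hPE, zero_mul, neg_zero]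

theorem mul_J_add_transpose_mul_eq_zero (hs : s.IsPHDAE T) (hP : MatC1On P T)
    (hker : ∀ t ∈ T, IsOrthProj (P t) (LinearMap.ker (s.E t).mulVecLin)) (ht : t ∈ T) :
    P t * (s.J t + (s.J t)ᵀ) * P t = 0 := by
  have h := hs.mul_matDeriv_E_mul_eq_zero hP hker ht
  have hEP := (hker t ht).mul_eq_zero
  have hPE : P t * s.E t = 0 := by
    simpa only [hs.E_symm t ht] using (hker t ht).mul_transpose_eq_zero
  rw [hs.skew_adjoint t ht, transpose_sub, transpose_mul, hs.E_symm t ht] at h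
  calc P t * (s.J t + (s.J t)ᵀ) * P t
      = P t * s.E t * s.K t * P t + P t * (s.K t)ᵀ * (s.E t * P t) -
          P t * (s.E t * s.K t - s.J t + ((s.K t)ᵀ * s.E t - (s.J t)ᵀ)) * P t := by noncomm_ring
    _ = 0 := by rw [h, hEP, hPE]; simp

theorem R_mulVec_eq_zero (hs : s.IsPHDAE T) (hP : MatC1On P T)
    (hker : ∀ t ∈ T, IsOrthProj (P t) (LinearMap.ker (s.E t).mulVecLin)) (ht : t ∈ T)
    (hx : x ∈ s.algKernel t) : s.R t *ᵥ x = 0 := by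
  have hPx : P t *ᵥ x = x := (hker t ht).mulVec_eq_iff.2 hx.1
  have hJ_add : x ⬝ᵥ ((s.J t + (s.J t)ᵀ) *ᵥ x) = 0 := by
    have h := congrArg (x ⬝ᵥ · *ᵥ x) (hs.mul_J_add_transpose_mul_eq_zero hP hker ht)
    simp only [← mulVec_mulVec, hPx, zero_mulVec, dotProduct_zero] at h
    rwa [dotProduct_mulVec, ← mulVec_transpose, (hker t ht).transpose_eq, hPx] at h
  have hJT : x ⬝ᵥ ((s.J t)ᵀ *ᵥ x) = x ⬝ᵥ (s.J t *ᵥ x) := by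
    rw [dotProduct_mulVec, ← mulVec_transpose, transpose_transpose, dotProduct_comm]
  have hJR : x ⬝ᵥ ((s.J t - s.R t) *ᵥ x) = 0 := hx.2 x hx.1
  rw [add_mulVec, dotProduct_add, hJT] at hJ_add
  rw [sub_mulVec, dotProduct_sub] at hJR
  refine ((hs.R_psd t ht).dotProduct_mulVec_zero_iff x).1 ?_
  rw [star_trivial]
  linarith

theorem R_mul_eq_zero (hs : s.IsPHDAE T) (hP : MatC1On P T)
    (hker : ∀ t ∈ T, IsOrthProj (P t) (LinearMap.ker (s.E t).mulVecLin)) (ht : t ∈ T)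
    {P' : Matrix n n ℝ} (hP' : IsOrthProj P' (s.algKernel t)) : s.R t * P' = 0 :=
  mulVec_injective <| funext fun x => by
    rw [← mulVec_mulVec, zero_mulVec, hs.R_mulVec_eq_zero hP hker ht (hP'.mulVec_mem x)]

theorem E_mulVec_derivWithin (hs : s.IsPHDAE T) {w : ℝ → n → ℝ} (hw : ContDiffOn ℝ 1 w T)
    (hE : ∀ t ∈ T, s.E t *ᵥ w t = 0) (hR : ∀ t ∈ T, s.R t *ᵥ w t = 0)
    (hJ : ∀ t ∈ T, (s.J t)ᵀ *ᵥ w t = 0) (ht : t ∈ T) :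
    s.E t *ᵥ derivWithin w T t = s.A t *ᵥ w t := by
  have h : derivWithin (fun t => s.E t *ᵥ w t) T t = 0 := by
    rw [derivWithin_congr (f := fun _ => (0 : n → ℝ)) hE (hE t ht), derivWithin_fun_const,
      Pi.zero_apply]
  rw [derivWithin_mulVec hs.E_C1 hw ht, hs.skew_adjoint t ht] at h
  rw [eq_neg_of_add_eq_zero_right h, A]
  simp only [transpose_sub, transpose_mul, hs.E_symm t ht, add_mulVec, sub_mulVec,
    ← mulVec_mulVec, hE t ht, hR t ht, hJ t ht, mulVec_zero]
  abel

end IsPHDAE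

end LTVSystem

end KernelOfE

section Staircase

section ComplementaryKernels

theorem finrank_map_add_finrank_inf_ker {V W : Type*} [AddCommGroup V] [Module ℝ V]
    [FiniteDimensional ℝ V] [AddCommGroup W] [Module ℝ W] (S : Submodule ℝ V) (f : V →ₗ[ℝ] W) :
    Module.finrank ℝ (S.map f) + Module.finrank ℝ ↥(S ⊓ LinearMap.ker f) = Module.finrank ℝ S := by
  have h := (f.domRestrict S).finrank_range_add_finrank_ker
  rw [LinearMap.range_domRestrict, LinearMap.ker_domRestrict] at h
  rw [← h, ← Submodule.map_comap_subtype,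
    (Submodule.equivMapOfInjective _ S.injective_subtype _).finrank_eq]

variable {m n : Type} [Fintype n] {P W : Matrix n n ℝ}

theorem isOrthProj_one_sub_ker_transpose [DecidableEq n] {M : Matrix n m ℝ}
    (hP : IsStarProjection P) (hM : ∀ x, P *ᵥ x = x → Mᵀ *ᵥ x = 0 → x = 0) :
    IsOrthProj (1 - P) (LinearMap.ker (P * M)ᵀ.mulVecLin) := by
  have hPT := transpose_eq_of_isStarProjection hP
  have hPP : P * P = P := hP.isIdempotentElem
  refine .of_mulVec (by rw [transpose_sub, transpose_one, hPT]) (fun x => ?_) fun x hx => ?_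
  · rw [LinearMap.mem_ker, mulVecLin_apply, transpose_mul, hPT, mulVec_mulVec, Matrix.mul_assoc,
      mul_sub, mul_one, hPP, sub_self, Matrix.mul_zero, zero_mulVec]
  · rw [LinearMap.mem_ker, mulVecLin_apply, transpose_mul, hPT, ← mulVec_mulVec] at hx
    rw [sub_mulVec, one_mulVec, hM _ (by rw [mulVec_mulVec, hPP]) hx, sub_zero]

theorem IsOrthProj.mul_eq_left_of_one_sub [DecidableEq n] {M : Matrix m n ℝ}
    (hP : IsOrthProj (1 - P) (LinearMap.ker M.mulVecLin)) (hM : M * W = M) : P * W = P := by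
  have h := hP.mul_eq_right (X := 1 - W) (by rw [Matrix.mul_sub, Matrix.mul_one, hM, sub_self])
  rw [sub_mul, one_mul, mul_sub, mul_one] at h
  exact (sub_eq_zero.1 (sub_eq_self.1 h)).symm

theorem IsOrthProj.ker_sub_mul_mul [Fintype m] [DecidableEq m] {P' : Matrix n n ℝ}
    {G : Matrix n m ℝ} {Q L : Matrix m m ℝ} (hPP' : P * P' = P)
    (hQ : IsOrthProj Q (LinearMap.ker (P * G).mulVecLin))
    (hL : IsOrthProj L (LinearMap.ker (P' * G).mulVecLin)) :
    IsOrthProj (1 - Q + L) (LinearMap.ker ((P' - P) * (G * Q)).mulVecLin) := by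
  have hle : LinearMap.ker (P' * G).mulVecLin ≤ LinearMap.ker (P * G).mulVecLin := fun x hx => by
    rw [LinearMap.mem_ker, mulVecLin_apply] at hx ⊢
    rw [← hPP', Matrix.mul_assoc, ← mulVec_mulVec, hx, mulVec_zero]
  have hQL : Q * L = L := hL.mul_eq_right_of_le hQ hle
  have hLQ : L * Q = L := hL.mul_eq_left_of_le hQ hle
  have hGQ : P * G * Q = 0 := hQ.mul_eq_zero
  have hGL : P' * G * L = 0 := hL.mul_eq_zero
  have hsub : (P' - P) * (G * Q) = P' * G * Q := by
    rw [Matrix.sub_mul, ← Matrix.mul_assoc, ← Matrix.mul_assoc, hGQ, sub_zero]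
  rw [hsub]
  refine .of_mulVec ?_ (fun x => ?_) fun x hx => ?_
  · rw [transpose_add, transpose_sub, transpose_one, hQ.transpose_eq, hL.transpose_eq]
  · have h : P' * G * Q * (1 - Q + L) = 0 := by
      rw [Matrix.mul_add, Matrix.mul_sub, Matrix.mul_one, Matrix.mul_assoc _ Q Q, hQ.mul_self,
        sub_self, zero_add, Matrix.mul_assoc _ Q L, hQL, hGL]
    rw [LinearMap.mem_ker, mulVecLin_apply, mulVec_mulVec, h, zero_mulVec]
  · rw [LinearMap.mem_ker, mulVecLin_apply, ← mulVec_mulVec] at hx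
    have hLx : L *ᵥ x = Q *ᵥ x := by
      rw [← hLQ, ← mulVec_mulVec]
      exact hL.mulVec_eq_iff.2 hx
    rw [add_mulVec, sub_mulVec, one_mulVec, hLx, sub_add_cancel]

theorem MatC1On.exists_isOrthProj_reachable [DecidableEq n] [Fintype m] {t₀ t₁ : ℝ}
    (hab : t₀ < t₁) {G : ℝ → Matrix n m ℝ} {P P' : ℝ → Matrix n n ℝ}
    (hG : MatC1On G (Set.Icc t₀ t₁)) (hP : MatC1On P (Set.Icc t₀ t₁))
    (hP' : MatC1On P' (Set.Icc t₀ t₁)) (hproj : ∀ t ∈ Set.Icc t₀ t₁, IsStarProjection (P t))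
    (hPP' : ∀ t ∈ Set.Icc t₀ t₁, P t * P' t = P t)
    (hinj : ∀ t ∈ Set.Icc t₀ t₁, ∀ x, P t *ᵥ x = x → (G t)ᵀ *ᵥ x = 0 → x = 0) {r : ℕ}
    (hr : ∀ t ∈ Set.Icc t₀ t₁, (P' t * G t).rank = r) :
    ∃ (Q L : ℝ → Matrix m m ℝ) (X : ℝ → Matrix n n ℝ), MatC1On Q (Set.Icc t₀ t₁) ∧
      MatC1On L (Set.Icc t₀ t₁) ∧ MatC1On X (Set.Icc t₀ t₁) ∧
      (∀ t ∈ Set.Icc t₀ t₁, IsOrthProj (Q t) (LinearMap.ker (P t * G t).mulVecLin)) ∧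
      (∀ t ∈ Set.Icc t₀ t₁, IsOrthProj (L t) (LinearMap.ker (P' t * G t).mulVecLin)) ∧
      ∀ t ∈ Set.Icc t₀ t₁,
        IsOrthProj (1 - X t) (LinearMap.ker ((P' t - P t) * (G t * Q t))ᵀ.mulVecLin) := by
  classical
  have hone {k : Type} [DecidableEq k] : MatC1On (fun _ => (1 : Matrix k k ℝ)) (Set.Icc t₀ t₁) :=
    .const 1 _
  obtain ⟨Q, hQ, hQ'⟩ := (hP.mul hG).exists_isOrthProj_ker_of_ker_transpose hab (hone.sub hP)
    fun t ht => isOrthProj_one_sub_ker_transpose (hproj t ht) (hinj t ht)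
  obtain ⟨L, hL, hL'⟩ := (hP'.mul hG).exists_isOrthProj_ker hr
  obtain ⟨X, hX, hX'⟩ := ((hP'.sub hP).mul (hG.mul hQ)).transpose
    |>.exists_isOrthProj_ker_of_ker_transpose hab ((hone.sub hQ).add hL) fun t ht => by
      rw [transpose_transpose]
      exact .ker_sub_mul_mul (hPP' t ht) (hQ' t ht) (hL' t ht)
  refine ⟨Q, L, fun t => 1 - X t, hQ, hL, hone.sub hX, hQ', hL', fun t ht => ?_⟩
  rw [sub_sub_cancel]
  exact hX' t ht

section Difference

variable [DecidableEq n] {P P' X : Matrix n n ℝ} {G : Matrix n m ℝ}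

theorem sub_mul_eq_self_of_isOrthProj_one_sub (hP : IsStarProjection P)
    (hP' : IsStarProjection P') (hPP' : P * P' = P)
    (hX : IsOrthProj (1 - X) (LinearMap.ker ((P' - P) * G)ᵀ.mulVecLin)) : (P' - P) * X = X := by
  have hsub := hP.sub_of_mul_eq_left hP' hPP'
  have hX' : X * (P' - P) = X := hX.mul_eq_left_of_one_sub (by
    rw [transpose_mul, transpose_eq_of_isStarProjection hsub, Matrix.mul_assoc,
      hsub.isIdempotentElem])
  simpa only [transpose_mul, transpose_eq_of_isStarProjection hsub,
    transpose_eq_of_isStarProjection (isStarProjection_one_sub_iff.1 hX.isStarProjection)] using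
    congrArg Matrix.transpose hX'

theorem isStarProjection_sub_sub (hP : IsStarProjection P) (hP' : IsStarProjection P')
    (hPP' : P * P' = P)
    (hX : IsOrthProj (1 - X) (LinearMap.ker ((P' - P) * G)ᵀ.mulVecLin)) :
    IsStarProjection (P' - P - X) :=
  (isStarProjection_one_sub_iff.1 hX.isStarProjection).sub_of_mul_eq_right
    (hP.sub_of_mul_eq_left hP' hPP') (sub_mul_eq_self_of_isOrthProj_one_sub hP hP' hPP' hX)

theorem mul_eq_zero_of_isOrthProj_one_sub (hP : IsStarProjection P) (hP' : IsStarProjection P')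
    (hPP' : P * P' = P)
    (hX : IsOrthProj (1 - X) (LinearMap.ker ((P' - P) * G)ᵀ.mulVecLin)) : P * X = 0 := by
  rw [← sub_mul_eq_self_of_isOrthProj_one_sub hP hP' hPP' hX, ← mul_assoc, mul_sub, hPP',
    hP.isIdempotentElem, sub_self, zero_mul]

theorem mul_eq_self_of_isOrthProj_one_sub (hP : IsStarProjection P) (hP' : IsStarProjection P')
    (hPP' : P * P' = P)
    (hX : IsOrthProj (1 - X) (LinearMap.ker ((P' - P) * G)ᵀ.mulVecLin)) : P' * X = X := by
  simpa only [sub_mul, mul_eq_zero_of_isOrthProj_one_sub hP hP' hPP' hX, sub_zero] using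
    sub_mul_eq_self_of_isOrthProj_one_sub hP hP' hPP' hX

end Difference

end ComplementaryKernels

/-- The orthogonal projections of the staircase reduction at a fixed time, see
`LTVSystem.IsStaircase` for the subspaces they project onto; `Q` and `L` act on the inputs. -/
structure StaircaseProj (n m : Type) where
  PE : Matrix n n ℝ
  PN : Matrix n n ℝ
  PZ : Matrix n n ℝ
  PX : Matrix n n ℝ
  PC : Matrix n n ℝ
  Q : Matrix m m ℝ
  L : Matrix m m ℝ

namespace StaircaseProj

variable {n m : Type}

/-- The projection onto the part of `𝒩` on which `(J - R)ᵀ` is injective and which the inputs left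
over by the sixth block row do not reach. -/
def PA (p : StaircaseProj n m) : Matrix n n ℝ := p.PN - p.PZ - p.PX

/-- The projections onto the six state blocks. -/
def stateProj [DecidableEq n] (p : StaircaseProj n m) : Fin 6 → Matrix n n ℝ :=
  ![1 - p.PC, p.PC - p.PE, p.PE - p.PN, p.PX, p.PA, p.PZ]

/-- The projections onto the three input blocks. -/
def inputProj [DecidableEq m] (p : StaircaseProj n m) : Fin 3 → Matrix m m ℝ :=
  ![p.L, p.Q - p.L, 1 - p.Q]

theorem sum_stateProj [DecidableEq n] (p : StaircaseProj n m) : ∑ i, p.stateProj i = 1 := by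
  simp only [stateProj, PA, Fin.sum_univ_six, cons_val]
  abel

theorem sum_inputProj [DecidableEq m] (p : StaircaseProj n m) : ∑ i, p.inputProj i = 1 := by
  simp only [inputProj, Fin.sum_univ_three, cons_val]
  abel

end StaircaseProj

namespace LTVSystem

variable {n m : Type} [Fintype n]

/-- The properties of the staircase projections at time `t` from which the condensed form is read
off. In the six block rows, `PZ` splits off the part of `𝒩` annihilated by `(J - R)ᵀ`, `PX` the
part of the rest that the inputs in the range of `Q` reach, and `PC` the states satisfying the
algebraic constraints that remain. -/
structure IsStaircase [DecidableEq n] [Fintype m] (s : LTVSystem n m) (t : ℝ)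
    (p : StaircaseProj n m) : Prop where
  PE : IsOrthProj p.PE (LinearMap.ker (s.E t).mulVecLin)
  PN : IsOrthProj p.PN (s.algKernel t)
  PZ : IsOrthProj p.PZ (s.algKernel t ⊓ LinearMap.ker ((s.J t - s.R t)ᵀ).mulVecLin)
  Q : IsOrthProj p.Q (LinearMap.ker (p.PZ * s.G t).mulVecLin)
  L : IsOrthProj p.L (LinearMap.ker (p.PN * s.G t).mulVecLin)
  PX : IsOrthProj (1 - p.PX) (LinearMap.ker ((p.PN - p.PZ) * (s.G t * p.Q))ᵀ.mulVecLin)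
  PC : IsOrthProj p.PC (LinearMap.ker (p.PA * (s.J t - s.R t)).mulVecLin)
  E_symm : (s.E t)ᵀ = s.E t
  R_symm : (s.R t)ᵀ = s.R t
  R_mul_PN : s.R t * p.PN = 0
  PE_mul_J_mul_PE : p.PE * (s.J t + (s.J t)ᵀ) * p.PE = 0
  eq_zero_of_G : ∀ x, p.PZ *ᵥ x = x → (s.G t)ᵀ *ᵥ x = 0 → x = 0

section Existence

variable {s : LTVSystem n m} {T : Set ℝ}

theorem exists_isOrthProj_algKernel [Fintype m] (hE : MatC1On s.E T) (hJ : MatC1On s.J T)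
    (hR : MatC1On s.R T) (hrank : s.HasConstantRanks T) :
    ∃ PE PN PZ : ℝ → Matrix n n ℝ, MatC1On PE T ∧ MatC1On PN T ∧ MatC1On PZ T ∧
      (∀ t ∈ T, IsOrthProj (PE t) (LinearMap.ker (s.E t).mulVecLin)) ∧
      (∀ t ∈ T, IsOrthProj (PN t) (s.algKernel t)) ∧
      ∀ t ∈ T, IsOrthProj (PZ t)
        (s.algKernel t ⊓ LinearMap.ker ((s.J t - s.R t)ᵀ).mulVecLin) := by
  obtain ⟨r₁, r₂, r₃, r₄, hr⟩ := hrank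
  obtain ⟨PE, hPE, hPE'⟩ := hE.exists_isOrthProj_ker fun t ht => (hr t ht).1
  obtain ⟨PN, hPN, hPN'⟩ := (hPE.mul (hJ.sub hR)).exists_isOrthProj_inf_ker hPE hPE'
    (r := Fintype.card n - r₁ - r₂) fun t ht => by
      have h := finrank_map_add_finrank_inf_ker (LinearMap.ker (s.E t).mulVecLin)
        (PE t * (s.J t - s.R t)).mulVecLin
      have hker := LinearMap.finrank_range_add_finrank_ker (s.E t).mulVecLin
      rw [← algKernel_eq_inf_ker (hPE' t ht), (hr t ht).2.1] at h
      rw [← Matrix.rank, (hr t ht).1, Module.finrank_pi] at hker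
      omega
  have hPN'' (t) (ht : t ∈ T) : IsOrthProj (PN t) (s.algKernel t) := by
    rw [algKernel_eq_inf_ker (hPE' t ht)]
    exact hPN' t ht
  obtain ⟨PZ, hPZ, hPZ'⟩ := (hJ.sub hR).transpose.exists_isOrthProj_inf_ker hPN hPN''
    fun t ht => (hr t ht).2.2.1
  exact ⟨PE, PN, PZ, hPE, hPN, hPZ, hPE', hPN'', hPZ'⟩

variable [DecidableEq n]

theorem eq_zero_of_mem_algKernel {PN PZ X : Matrix n n ℝ} {M : Matrix n m ℝ} {t : ℝ}
    (hPN : IsOrthProj PN (s.algKernel t))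
    (hPZ : IsOrthProj PZ (s.algKernel t ⊓ LinearMap.ker ((s.J t - s.R t)ᵀ).mulVecLin))
    (hX : IsOrthProj (1 - X) (LinearMap.ker ((PN - PZ) * M)ᵀ.mulVecLin)) {x : n → ℝ}
    (hx : (PN - PZ - X) *ᵥ x = x) (hJx : (s.J t - s.R t)ᵀ *ᵥ x = 0) : x = 0 := by
  have hZN := hPZ.mul_eq_left_of_le hPN inf_le_left
  have hNX := mul_eq_self_of_isOrthProj_one_sub hPZ.isStarProjection hPN.isStarProjection hZN hX
  have hZX := mul_eq_zero_of_isOrthProj_one_sub hPZ.isStarProjection hPN.isStarProjection hZN hX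
  have hxN : PN *ᵥ x = x := by
    conv_lhs => rw [← hx, mulVec_mulVec, mul_sub, mul_sub, hPN.mul_self,
      hPZ.mul_eq_right_of_le hPN inf_le_left, hNX, hx]
  have hxZ : PZ *ᵥ x = x := hPZ.mulVec_eq_iff.2 ⟨hPN.mulVec_eq_iff.1 hxN, hJx⟩
  rw [← hxZ, ← hx, mulVec_mulVec, mul_sub, mul_sub, hZN, hPZ.mul_self, hZX, sub_self, sub_zero,
    zero_mulVec]

theorem IsPHDAE.exists_isStaircase [Fintype m] [DecidableEq m] {t₀ t₁ : ℝ} (hab : t₀ < t₁)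
    (hs : s.IsPHDAE (Set.Icc t₀ t₁)) (hJ : MatC1On s.J (Set.Icc t₀ t₁))
    (hR : MatC1On s.R (Set.Icc t₀ t₁)) (hG : MatC1On s.G (Set.Icc t₀ t₁))
    (hrank : s.HasConstantRanks (Set.Icc t₀ t₁))
    (hinj : ∀ t ∈ Set.Icc t₀ t₁, ∀ x ∈ s.algKernel t,
      (s.J t - s.R t)ᵀ *ᵥ x = 0 → (s.G t)ᵀ *ᵥ x = 0 → x = 0) :
    ∃ p : ℝ → StaircaseProj n m,
      (∀ i, MatC1On (fun t => (p t).stateProj i) (Set.Icc t₀ t₁)) ∧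
      (∀ j, MatC1On (fun t => (p t).inputProj j) (Set.Icc t₀ t₁)) ∧
      ∀ t ∈ Set.Icc t₀ t₁, s.IsStaircase t (p t) := by
  obtain ⟨PE, PN, PZ, hPE, hPN, hPZ, hE', hN', hZ'⟩ :=
    exists_isOrthProj_algKernel hs.E_C1 hJ hR hrank
  have hZN (t) (ht : t ∈ Set.Icc t₀ t₁) : PZ t * PN t = PZ t :=
    (hZ' t ht).mul_eq_left_of_le (hN' t ht) inf_le_left
  have hinjG (t) (ht : t ∈ Set.Icc t₀ t₁) (x) (hx : PZ t *ᵥ x = x) :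
      (s.G t)ᵀ *ᵥ x = 0 → x = 0 :=
    let hmem := (hZ' t ht).mulVec_eq_iff.1 hx
    hinj t ht x hmem.1 hmem.2
  obtain ⟨r, hr⟩ : ∃ r, ∀ t ∈ Set.Icc t₀ t₁, (PN t * s.G t).rank = r := by
    obtain ⟨_, _, _, r₄, hr⟩ := hrank
    refine ⟨r₄, fun t ht => ?_⟩
    rw [← Matrix.rank_transpose (PN t * s.G t), transpose_mul, (hN' t ht).transpose_eq,
      (hN' t ht).rank_mul, (hr t ht).2.2.2]
  obtain ⟨Q, L, PX, hQ, hL, hPX, hQ', hL', hX'⟩ := hG.exists_isOrthProj_reachable hab hPZ hPN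
    (fun t ht => (hZ' t ht).isStarProjection) hZN hinjG hr
  have hPA : MatC1On (fun t => PN t - PZ t - PX t) (Set.Icc t₀ t₁) := (hPN.sub hPZ).sub hPX
  obtain ⟨PC, hPC, hC'⟩ := (hPA.mul (hJ.sub hR)).exists_isOrthProj_ker_of_ker_transpose hab
    ((MatC1On.const 1 _).sub hPA) fun t ht => isOrthProj_one_sub_ker_transpose
      (isStarProjection_sub_sub (hZ' t ht).isStarProjection (hN' t ht).isStarProjection
        (hZN t ht) (hX' t ht))
      fun x hx => eq_zero_of_mem_algKernel (hN' t ht) (hZ' t ht) (hX' t ht) hx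
  refine ⟨fun t => ⟨PE t, PN t, PZ t, PX t, PC t, Q t, L t⟩, fun i => ?_, fun j => ?_,
    fun t ht => ⟨hE' t ht, hN' t ht, hZ' t ht, hQ' t ht, hL' t ht, hX' t ht, hC' t ht,
      hs.E_symm t ht, hs.R_transpose ht, hs.R_mul_eq_zero hPE hE' ht (hN' t ht),
      hs.mul_J_add_transpose_mul_eq_zero hPE hE' ht, hinjG t ht⟩⟩
  · fin_cases i
    exacts [(MatC1On.const 1 _).sub hPC, hPC.sub hPE, hPE.sub hPN, hPX, hPA, hPZ]
  · fin_cases j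
    exacts [hL, hQ.sub hL, (MatC1On.const 1 _).sub hQ]

end Existence

end LTVSystem

end Staircase

section Patterns

theorem patternE_eq_zero_iff (i j : Fin 6) : patternE i j = 0 ↔ 2 ≤ i ∨ 2 ≤ j := by
  fin_cases i <;> fin_cases j <;> simp [patternE]

theorem patternJ_eq_zero_iff (i j : Fin 6) : patternJ i j = 0 ↔ 5 ≤ (i : ℕ) + j := by
  fin_cases i <;> fin_cases j <;> simp [patternJ]

theorem patternR_eq_zero_iff (i j : Fin 6) : patternR i j = 0 ↔ 3 ≤ i ∨ 3 ≤ j := by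
  fin_cases i <;> fin_cases j <;> simp [patternR]

theorem patternK_eq_zero_iff (i j : Fin 6) : patternK i j = 0 ↔ 2 ≤ i ∨ 4 ≤ j := by
  fin_cases i <;> fin_cases j <;> simp [patternK]

theorem patternG_eq_zero_iff (i : Fin 6) (j : Fin 3) :
    patternG i j = 0 ↔ 3 ≤ i ∧ j = 0 ∨ 4 ≤ i ∧ j = 1 := by
  fin_cases i <;> fin_cases j <;> simp [patternG]

end Patterns

section Nondegeneracy

variable {k l m n : Type} [Fintype k] [DecidableEq k] [Fintype l] [DecidableEq l]
  [Fintype m] [Fintype n]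

theorem isInvertibleMatrix_of_square_of_injective {M : Matrix k k ℝ}
    (hM : ∀ x, M *ᵥ x = 0 → x = 0) : IsInvertibleMatrix M := by
  obtain ⟨u, rfl⟩ : IsUnit M :=
    mulVec_injective_iff_isUnit.1 ((injective_iff_map_eq_zero M.mulVecLin).2 hM)
  exact ⟨(u⁻¹ : (Matrix k k ℝ)ˣ), u.mul_inv, u.inv_mul⟩

theorem isInvertibleMatrix_of_injective {M : Matrix k l ℝ} (hM : ∀ x, M *ᵥ x = 0 → x = 0)
    (hMT : ∀ x, Mᵀ *ᵥ x = 0 → x = 0) : IsInvertibleMatrix M := by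
  obtain ⟨B, hB, hB'⟩ := isInvertibleMatrix_of_square_of_injective (M := Mᵀ * M) fun x hx =>
    hM x <| by
      rwa [← conjTranspose_eq_transpose_of_trivial, conjTranspose_mul_self_mulVec_eq_zero] at hx
  refine ⟨B * Mᵀ, mulVec_injective <| funext fun x => sub_eq_zero.1 (hMT _ ?_),
    by rw [Matrix.mul_assoc, hB']⟩
  rw [mulVec_sub, mulVec_mulVec, mulVec_mulVec, Matrix.mul_one, ← Matrix.mul_assoc,
    ← Matrix.mul_assoc, hB, Matrix.one_mul, sub_self]

theorem IsInvertibleMatrix.neg_transpose {M : Matrix k l ℝ} (hM : IsInvertibleMatrix M) :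
    IsInvertibleMatrix (-Mᵀ) := by
  obtain ⟨B, hMB, hBM⟩ := hM
  exact ⟨-Bᵀ, by rw [Matrix.neg_mul, Matrix.mul_neg, neg_neg, ← transpose_mul, hBM, transpose_one],
    by rw [Matrix.neg_mul, Matrix.mul_neg, neg_neg, ← transpose_mul, hMB, transpose_one]⟩

theorem IsInvertibleMatrix.eq_zero_of_mulVec {M : Matrix k l ℝ} (hM : IsInvertibleMatrix M)
    {x : l → ℝ} (hx : M *ᵥ x = 0) : x = 0 := by
  obtain ⟨B, -, hBM⟩ := hM
  rw [← one_mulVec x, ← hBM, ← mulVec_mulVec, hx, mulVec_zero]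

namespace IsFrame

variable {F : Matrix n k ℝ} {P : Matrix n n ℝ}

theorem mulVec_mulVec_self (hF : IsFrame F P) (x : k → ℝ) : P *ᵥ (F *ᵥ x) = F *ᵥ x := by
  rw [mulVec_mulVec, hF.mul_eq]

theorem mulVec_eq_zero (hF : IsFrame F P) {x : k → ℝ} (hx : F *ᵥ x = 0) : x = 0 := by
  rw [← one_mulVec x, ← hF.transpose_mul_self, ← mulVec_mulVec, hx, mulVec_zero]

theorem mulVec_eq_zero_of_transpose_mulVec (hF : IsFrame F P) {x : n → ℝ} (hx : Fᵀ *ᵥ x = 0) :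
    P *ᵥ x = 0 := by
  rw [← hF.mul_transpose_self, ← mulVec_mulVec, hx, mulVec_zero]

theorem isInvertibleMatrix_conj_self {M : Matrix n n ℝ} (hF : IsFrame F P)
    (hM : ∀ x, P *ᵥ x = x → P *ᵥ (M *ᵥ x) = 0 → x = 0) : IsInvertibleMatrix (Fᵀ * M * F) := by
  refine isInvertibleMatrix_of_square_of_injective fun x hx => ?_
  rw [Matrix.mul_assoc, ← mulVec_mulVec] at hx
  refine hF.mulVec_eq_zero (hM _ (hF.mulVec_mulVec_self x) ?_)
  simpa only [mulVec_mulVec] using hF.mulVec_eq_zero_of_transpose_mulVec hx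

theorem conj_eq_zero {H : Matrix m l ℝ} {Q : Matrix m m ℝ} {M : Matrix n m ℝ} (hF : IsFrame F P)
    (hH : IsFrame H Q) (hM : P * M * Q = 0) : Fᵀ * M * H = 0 := by
  rw [← hF.transpose_mul_eq, ← hH.mul_eq, ← Matrix.mul_assoc, Matrix.mul_assoc Fᵀ,
    Matrix.mul_assoc Fᵀ, hM, Matrix.mul_zero, Matrix.zero_mul]

variable [DecidableEq m] [DecidableEq n]

theorem eq_zero_of_conj_mulVec {H : Matrix m l ℝ} {Q : Matrix m m ℝ} {M : Matrix n m ℝ}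
    (hF : IsFrame F P) (hH : IsFrame H Q) (hP : IsOrthProj (1 - P) (LinearMap.ker Mᵀ.mulVecLin))
    (hQ : IsOrthProj (1 - Q) (LinearMap.ker M.mulVecLin)) {x : l → ℝ}
    (hx : (Fᵀ * M * H) *ᵥ x = 0) : x = 0 := by
  have hPM : P * M = M := by
    have h := hP.mul_transpose_eq_zero
    rw [transpose_transpose, Matrix.sub_mul, Matrix.one_mul] at h
    exact (sub_eq_zero.1 h).symm
  rw [Matrix.mul_assoc, ← mulVec_mulVec] at hx
  have hMHx : M *ᵥ (H *ᵥ x) = 0 := by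
    simpa only [mulVec_mulVec, ← Matrix.mul_assoc, hPM] using
      hF.mulVec_eq_zero_of_transpose_mulVec hx
  have hQHx := hQ.mulVec_eq_iff.2 hMHx
  rw [sub_mulVec, one_mulVec, hH.mulVec_mulVec_self, sub_self] at hQHx
  exact hH.mulVec_eq_zero hQHx.symm

theorem isInvertibleMatrix_conj {H : Matrix m l ℝ} {Q : Matrix m m ℝ} {M : Matrix n m ℝ}
    (hF : IsFrame F P) (hH : IsFrame H Q) (hP : IsOrthProj (1 - P) (LinearMap.ker Mᵀ.mulVecLin))
    (hQ : IsOrthProj (1 - Q) (LinearMap.ker M.mulVecLin)) : IsInvertibleMatrix (Fᵀ * M * H) := by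
  refine isInvertibleMatrix_of_injective (fun x => hF.eq_zero_of_conj_mulVec hH hP hQ) fun x hx =>
    hH.eq_zero_of_conj_mulVec (M := Mᵀ) hF (by rwa [transpose_transpose]) hP ?_
  rwa [transpose_mul, transpose_mul, transpose_transpose, ← Matrix.mul_assoc] at hx

end IsFrame

end Nondegeneracy

theorem LTVSystem.posSemidef_E_of_hamiltonian_nonneg {n m : Type} [Fintype n]
    (s : LTVSystem n m) {t : ℝ} (hE : (s.E t)ᵀ = s.E t) (hH : ∀ z, 0 ≤ s.hamiltonian t z) :
    (s.E t).PosSemidef := by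
  refine .of_dotProduct_mulVec_nonneg ?_ fun z => ?_
  · rwa [IsHermitian, conjTranspose_eq_transpose_of_trivial]
  · rw [star_trivial]
    exact nonneg_of_mul_nonneg_right (hH z) one_half_pos

namespace LTVSystem.IsStaircase

variable {n m : Type} [Fintype n] [DecidableEq n] [Fintype m] {s : LTVSystem n m}
  {t : ℝ} {p : StaircaseProj n m}

theorem PE_mul_PN (h : s.IsStaircase t p) : p.PE * p.PN = p.PN :=
  h.PN.mul_eq_right_of_le h.PE fun _ hx => hx.1

theorem PN_mul_PE (h : s.IsStaircase t p) : p.PN * p.PE = p.PN :=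
  h.PN.mul_eq_left_of_le h.PE fun _ hx => hx.1

theorem PN_mul_PZ (h : s.IsStaircase t p) : p.PN * p.PZ = p.PZ :=
  h.PZ.mul_eq_right_of_le h.PN inf_le_left

theorem PZ_mul_PN (h : s.IsStaircase t p) : p.PZ * p.PN = p.PZ :=
  h.PZ.mul_eq_left_of_le h.PN inf_le_left

theorem isStarProjection_PX (h : s.IsStaircase t p) : IsStarProjection p.PX :=
  isStarProjection_one_sub_iff.1 h.PX.isStarProjection

theorem isStarProjection_PA (h : s.IsStaircase t p) : IsStarProjection p.PA :=
  isStarProjection_sub_sub h.PZ.isStarProjection h.PN.isStarProjection h.PZ_mul_PN h.PX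

theorem PN_mul_PX (h : s.IsStaircase t p) : p.PN * p.PX = p.PX :=
  mul_eq_self_of_isOrthProj_one_sub h.PZ.isStarProjection h.PN.isStarProjection h.PZ_mul_PN h.PX

theorem PN_mul_PA (h : s.IsStaircase t p) : p.PN * p.PA = p.PA := by
  rw [StaircaseProj.PA, mul_sub, mul_sub, h.PN.mul_self, h.PN_mul_PZ, h.PN_mul_PX]

theorem PN_mul_stateProj (h : s.IsStaircase t p) {i : Fin 6} (hi : 3 ≤ i) :
    p.PN * p.stateProj i = p.stateProj i := by
  fin_cases i
  · simp at hi
  · simp at hi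
  · simp at hi
  exacts [h.PN_mul_PX, h.PN_mul_PA, h.PN_mul_PZ]

theorem PE_mul_stateProj (h : s.IsStaircase t p) {i : Fin 6} (hi : 2 ≤ i) :
    p.PE * p.stateProj i = p.stateProj i := by
  obtain rfl | hi' : i = 2 ∨ 3 ≤ i := by omega
  · change p.PE * (p.PE - p.PN) = p.PE - p.PN
    rw [mul_sub, h.PE.mul_self, h.PE_mul_PN]
  · rw [← h.PN_mul_stateProj hi', ← mul_assoc, h.PE_mul_PN]

theorem E_mul_stateProj (h : s.IsStaircase t p) {i : Fin 6} (hi : 2 ≤ i) :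
    s.E t * p.stateProj i = 0 := by
  rw [← h.PE_mul_stateProj hi, ← mul_assoc, h.PE.mul_eq_zero, zero_mul]

theorem R_mul_stateProj (h : s.IsStaircase t p) {i : Fin 6} (hi : 3 ≤ i) :
    s.R t * p.stateProj i = 0 := by
  rw [← h.PN_mul_stateProj hi, ← mul_assoc, h.R_mul_PN, zero_mul]

theorem PN_mul_R (h : s.IsStaircase t p) : p.PN * s.R t = 0 := by
  simpa only [transpose_mul, h.R_symm, h.PN.transpose_eq, transpose_zero] using
    congrArg Matrix.transpose h.R_mul_PN

theorem PE_mul_J_mul_PN (h : s.IsStaircase t p) : p.PE * s.J t * p.PN = 0 := by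
  have hJR : p.PE * (s.J t - s.R t) * p.PN = 0 := mulVec_injective <| funext fun x => by
    rw [← mulVec_mulVec, zero_mulVec]
    exact (algKernel_eq_inf_ker h.PE ▸ h.PN.mulVec_mem x).2
  rwa [mul_sub, sub_mul, mul_assoc _ (s.R t), h.R_mul_PN, mul_zero, sub_zero] at hJR

theorem PN_mul_J_mul_PE (h : s.IsStaircase t p) : p.PN * s.J t * p.PE = 0 := by
  have hJT : p.PN * (s.J t)ᵀ * p.PE = 0 := by
    simpa only [transpose_mul, h.PE.transpose_eq, h.PN.transpose_eq, transpose_zero,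
      ← mul_assoc] using congrArg Matrix.transpose h.PE_mul_J_mul_PN
  have hsum := congrArg (p.PN * ·) h.PE_mul_J_mul_PE
  simpa only [← mul_assoc, h.PN_mul_PE, mul_add, add_mul, hJT, add_zero, mul_zero] using hsum

theorem PN_mul_JR_mul_PE (h : s.IsStaircase t p) : p.PN * (s.J t - s.R t) * p.PE = 0 := by
  rw [mul_sub, h.PN_mul_R, sub_zero, h.PN_mul_J_mul_PE]

theorem PC_mul_PE (h : s.IsStaircase t p) : p.PC * p.PE = p.PE := by
  refine h.PC.mul_eq_right ?_
  have hA : p.PA * p.PN = p.PA := by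
    simpa only [transpose_mul, h.PN.transpose_eq,
      transpose_eq_of_isStarProjection h.isStarProjection_PA] using
      congrArg Matrix.transpose h.PN_mul_PA
  rw [← hA, mul_assoc, mul_assoc, ← mul_assoc p.PN, h.PN_mul_JR_mul_PE, mul_zero]

theorem PE_mul_PC (h : s.IsStaircase t p) : p.PE * p.PC = p.PE := by
  simpa only [transpose_mul, h.PC.transpose_eq, h.PE.transpose_eq] using
    congrArg Matrix.transpose h.PC_mul_PE

theorem isStarProjection_stateProj (h : s.IsStaircase t p) (i : Fin 6) :
    IsStarProjection (p.stateProj i) := by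
  fin_cases i
  exacts [h.PC.isStarProjection.one_sub,
    h.PE.isStarProjection.sub_of_mul_eq_right h.PC.isStarProjection h.PC_mul_PE,
    h.PN.isStarProjection.sub_of_mul_eq_left h.PE.isStarProjection h.PN_mul_PE,
    h.isStarProjection_PX, h.isStarProjection_PA, h.PZ.isStarProjection]

theorem transpose_stateProj (h : s.IsStaircase t p) (i : Fin 6) :
    (p.stateProj i)ᵀ = p.stateProj i :=
  transpose_eq_of_isStarProjection (h.isStarProjection_stateProj i)

theorem stateProj_mul_PN (h : s.IsStaircase t p) {i : Fin 6} (hi : 3 ≤ i) :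
    p.stateProj i * p.PN = p.stateProj i := by
  simpa only [transpose_mul, h.PN.transpose_eq, h.transpose_stateProj] using
    congrArg Matrix.transpose (h.PN_mul_stateProj hi)

theorem stateProj_mul_PE (h : s.IsStaircase t p) {i : Fin 6} (hi : 2 ≤ i) :
    p.stateProj i * p.PE = p.stateProj i := by
  simpa only [transpose_mul, h.PE.transpose_eq, h.transpose_stateProj] using
    congrArg Matrix.transpose (h.PE_mul_stateProj hi)

theorem PZ_mul_J (h : s.IsStaircase t p) : p.PZ * s.J t = 0 := by
  have hJR : (s.J t - s.R t)ᵀ * p.PZ = 0 := mulVec_injective <| funext fun x => by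
    rw [← mulVec_mulVec, zero_mulVec]
    exact (h.PZ.mulVec_mem x).2
  have hJR' := congrArg Matrix.transpose hJR
  rwa [transpose_mul, transpose_transpose, h.PZ.transpose_eq, mul_sub, ← h.PZ_mul_PN,
    mul_assoc _ _ (s.R t), h.PN_mul_R, mul_zero, sub_zero, h.PZ_mul_PN, transpose_zero] at hJR'

theorem PA_mul_R (h : s.IsStaircase t p) : p.PA * s.R t = 0 := by
  have hA : p.PA * p.PN = p.PA := h.stateProj_mul_PN (i := 4) (by decide)
  rw [← hA, mul_assoc, h.PN_mul_R, mul_zero]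

theorem PA_mul_J_mul_PC (h : s.IsStaircase t p) : p.PA * s.J t * p.PC = 0 := by
  have hC := h.PC.mul_eq_zero
  rwa [mul_sub, h.PA_mul_R, sub_zero] at hC

theorem stateProj_mul_J_mul_stateProj (h : s.IsStaircase t p) {i j : Fin 6} (hi : 2 ≤ i)
    (hij : patternJ i j = 0) : p.stateProj i * s.J t * p.stateProj j = 0 := by
  have hcases : i = 5 ∨ i = 4 ∧ j = 1 ∨ 3 ≤ j ∨ 3 ≤ i ∧ 2 ≤ j := by
    rw [patternJ_eq_zero_iff] at hij
    omega
  obtain rfl | ⟨rfl, rfl⟩ | hj | ⟨hi', hj⟩ := hcases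
  · change p.PZ * s.J t * _ = 0
    rw [h.PZ_mul_J, zero_mul]
  · change p.PA * s.J t * (p.PC - p.PE) = 0
    rw [← h.PC_mul_PE, mul_sub, ← mul_assoc, h.PA_mul_J_mul_PC, zero_mul, sub_zero]
  · rw [← h.stateProj_mul_PE hi, ← h.PN_mul_stateProj hj, ← mul_assoc, mul_assoc _ p.PE,
      mul_assoc (p.stateProj i), h.PE_mul_J_mul_PN, mul_zero, zero_mul]
  · rw [← h.stateProj_mul_PN hi', ← h.PE_mul_stateProj hj, ← mul_assoc, mul_assoc _ p.PN,
      mul_assoc (p.stateProj i), h.PN_mul_J_mul_PE, mul_zero, zero_mul]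

section Inputs

theorem Q_mul_L (h : s.IsStaircase t p) : p.Q * p.L = p.L :=
  h.Q.mul_eq_right <| by
    rw [← h.PZ_mul_PN, Matrix.mul_assoc, Matrix.mul_assoc, ← Matrix.mul_assoc p.PN,
      h.L.mul_eq_zero, Matrix.mul_zero]

theorem PX_mul_sub (h : s.IsStaircase t p) : p.PX * (p.PN - p.PZ) = p.PX := by
  simpa only [transpose_mul, transpose_sub, h.PN.transpose_eq, h.PZ.transpose_eq,
    transpose_eq_of_isStarProjection h.isStarProjection_PX] using
    congrArg Matrix.transpose (sub_mul_eq_self_of_isOrthProj_one_sub h.PZ.isStarProjection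
      h.PN.isStarProjection h.PZ_mul_PN h.PX)

theorem PA_mul_G_mul_Q (h : s.IsStaircase t p) : p.PA * s.G t * p.Q = 0 := by
  have hA : p.PA = (1 - p.PX) * (p.PN - p.PZ) := by
    rw [StaircaseProj.PA, sub_mul, one_mul, h.PX_mul_sub]
  have hX := h.PX.mul_transpose_eq_zero
  rwa [transpose_transpose, ← Matrix.mul_assoc, ← hA, ← Matrix.mul_assoc] at hX

theorem stateProj_mul_G_mul_L (h : s.IsStaircase t p) {i : Fin 6} (hi : 3 ≤ i) :
    p.stateProj i * s.G t * p.L = 0 := by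
  rw [← h.stateProj_mul_PN hi, Matrix.mul_assoc (p.stateProj i), Matrix.mul_assoc,
    h.L.mul_eq_zero, Matrix.mul_zero]

variable [DecidableEq m]

theorem isStarProjection_inputProj (h : s.IsStaircase t p) (j : Fin 3) :
    IsStarProjection (p.inputProj j) := by
  fin_cases j
  exacts [h.L.isStarProjection,
    h.L.isStarProjection.sub_of_mul_eq_right h.Q.isStarProjection h.Q_mul_L,
    h.Q.isStarProjection.one_sub]

theorem stateProj_mul_G_mul_inputProj (h : s.IsStaircase t p) {i : Fin 6} {j : Fin 3}
    (hij : patternG i j = 0) : p.stateProj i * s.G t * p.inputProj j = 0 := by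
  have hcases : 3 ≤ i ∧ j = 0 ∨ i = 4 ∧ j = 1 ∨ i = 5 ∧ j = 1 := by
    rw [patternG_eq_zero_iff] at hij
    omega
  obtain ⟨hi, rfl⟩ | ⟨rfl, rfl⟩ | ⟨rfl, rfl⟩ := hcases
  · exact h.stateProj_mul_G_mul_L hi
  · change p.PA * s.G t * (p.Q - p.L) = 0
    rw [← h.Q_mul_L, Matrix.mul_sub, ← Matrix.mul_assoc, h.PA_mul_G_mul_Q, Matrix.zero_mul,
      sub_zero]
  · change p.PZ * s.G t * (p.Q - p.L) = 0
    rw [← h.Q_mul_L, Matrix.mul_sub, ← Matrix.mul_assoc, h.Q.mul_eq_zero, Matrix.zero_mul,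
      sub_zero]

end Inputs

section Blocks

variable {k l : Type} [Fintype k] [DecidableEq k] [Fintype l] [DecidableEq l]

theorem isInvertibleMatrix_conj_E (h : s.IsStaircase t p) (hH : ∀ z, 0 ≤ s.hamiltonian t z)
    {F : Matrix n k ℝ} (hF : IsFrame F (p.stateProj 1)) :
    IsInvertibleMatrix (Fᵀ * s.E t * F) := by
  refine hF.isInvertibleMatrix_conj_self fun x hx hEx => ?_
  have hxEx : x ⬝ᵥ (s.E t *ᵥ x) = 0 := by
    conv_lhs => rw [← hx, ← h.transpose_stateProj, mulVec_transpose, ← dotProduct_mulVec,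
      ← mulVec_transpose, h.transpose_stateProj, hx, hEx, dotProduct_zero]
  have hxE : s.E t *ᵥ x = 0 := by
    simpa using ((s.posSemidef_E_of_hamiltonian_nonneg h.E_symm hH).dotProduct_mulVec_zero_iff
      x).1 (by simpa using hxEx)
  have hPE : p.PE * p.stateProj 1 = 0 := by
    change p.PE * (p.PC - p.PE) = 0
    rw [mul_sub, h.PE_mul_PC, h.PE.mul_self, sub_self]
  rw [← h.PE.mulVec_eq_iff.2 hxE, ← hx, mulVec_mulVec, hPE, zero_mulVec]

theorem isInvertibleMatrix_conj_JR (h : s.IsStaircase t p) {F : Matrix n k ℝ}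
    (hF : IsFrame F (p.stateProj 2)) : IsInvertibleMatrix (Fᵀ * (s.J t - s.R t) * F) := by
  refine hF.isInvertibleMatrix_conj_self fun x hx hJRx => ?_
  have hPEx : p.PE *ᵥ x = x := by
    conv_lhs => rw [← hx, mulVec_mulVec, h.PE_mul_stateProj (by decide), hx]
  have hPNx : p.PN *ᵥ x = 0 := by
    have hPN : p.PN * p.stateProj 2 = 0 := by
      change p.PN * (p.PE - p.PN) = 0
      rw [mul_sub, h.PN_mul_PE, h.PN.mul_self, sub_self]
    rw [← hx, mulVec_mulVec, hPN, zero_mulVec]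
  have hPNJRx : p.PN *ᵥ ((s.J t - s.R t) *ᵥ x) = 0 := by
    conv_lhs => rw [← hPEx, mulVec_mulVec, mulVec_mulVec, h.PN_mul_JR_mul_PE, zero_mulVec]
  change (p.PE - p.PN) *ᵥ _ = 0 at hJRx
  rw [sub_mulVec, hPNJRx, sub_zero] at hJRx
  rw [← hPNx, eq_comm, h.PN.mulVec_eq_iff, algKernel_eq_inf_ker h.PE]
  exact ⟨h.PE.mulVec_eq_iff.1 hPEx, by
    rwa [SetLike.mem_coe, LinearMap.mem_ker, mulVecLin_apply, ← mulVec_mulVec]⟩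

theorem isInvertibleMatrix_conj_J (h : s.IsStaircase t p) {F : Matrix n k ℝ} {H : Matrix n l ℝ}
    (hF : IsFrame F (p.stateProj 4)) (hH : IsFrame H (p.stateProj 0)) :
    IsInvertibleMatrix (Fᵀ * s.J t * H) := by
  have hA := isOrthProj_one_sub_ker_transpose (M := s.J t - s.R t) h.isStarProjection_PA
    fun x hx => eq_zero_of_mem_algKernel h.PN h.PZ h.PX hx
  have hinv := hF.isInvertibleMatrix_conj hH hA
    (by rw [StaircaseProj.stateProj, cons_val_zero, sub_sub_cancel]; exact h.PC)
  have hFA : Fᵀ * p.PA = Fᵀ := hF.transpose_mul_eq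
  rwa [mul_sub, h.PA_mul_R, sub_zero, ← Matrix.mul_assoc, hFA] at hinv

theorem isInvertibleMatrix_conj_G_reached [DecidableEq m] (h : s.IsStaircase t p)
    {F : Matrix n k ℝ} {H : Matrix m l ℝ} (hF : IsFrame F (p.stateProj 3))
    (hH : IsFrame H (p.inputProj 1)) : IsInvertibleMatrix (Fᵀ * s.G t * H) := by
  have hinv := hF.isInvertibleMatrix_conj hH h.PX
    (by
      change IsOrthProj (1 - (p.Q - p.L)) _
      rw [← sub_add]
      exact .ker_sub_mul_mul h.PZ_mul_PN h.Q h.L)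
  have hFX : Fᵀ * (p.PN - p.PZ) = Fᵀ := by
    have hFX : Fᵀ * p.PX = Fᵀ := hF.transpose_mul_eq
    rw [← hFX, Matrix.mul_assoc, h.PX_mul_sub]
  have hQH : p.Q * H = H := by
    have hQ : p.Q * p.inputProj 1 = p.inputProj 1 := by
      change p.Q * (p.Q - p.L) = p.Q - p.L
      rw [mul_sub, h.Q.mul_self, h.Q_mul_L]
    rw [← hH.mul_eq, ← Matrix.mul_assoc, hQ]
  rwa [← Matrix.mul_assoc, hFX, ← Matrix.mul_assoc, Matrix.mul_assoc _ p.Q, hQH] at hinv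

theorem isInvertibleMatrix_conj_G_annihilated [DecidableEq m] (h : s.IsStaircase t p)
    {F : Matrix n k ℝ} {H : Matrix m l ℝ} (hF : IsFrame F (p.stateProj 5))
    (hH : IsFrame H (p.inputProj 2)) : IsInvertibleMatrix (Fᵀ * s.G t * H) := by
  have hZ := isOrthProj_one_sub_ker_transpose h.PZ.isStarProjection h.eq_zero_of_G
  have hinv := hF.isInvertibleMatrix_conj hH hZ
    (by
      change IsOrthProj (1 - (1 - p.Q)) _
      rw [sub_sub_cancel]
      exact h.Q)
  have hFZ : Fᵀ * p.PZ = Fᵀ := hF.transpose_mul_eq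
  rwa [← Matrix.mul_assoc, hFZ] at hinv

end Blocks

end LTVSystem.IsStaircase

section Blocks

variable {k l q : ℕ} {d : Fin k → ℕ} {e : Fin l → ℕ} {f : Fin q → ℕ}

theorem blk_sub (M N : Matrix (BlockIdx d) (BlockIdx e) ℝ) (i : Fin k) (j : Fin l) :
    blk (M - N) i j = blk M i j - blk N i j :=
  rfl

theorem blk_mul (M : Matrix (BlockIdx d) (BlockIdx e) ℝ) (N : Matrix (BlockIdx e) (BlockIdx f) ℝ)
    (i : Fin k) (j : Fin q) : blk (M * N) i j = ∑ r, blk M i r * blk N r j := by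
  ext a b
  simp only [blk, of_apply, mul_apply, Fintype.sum_sigma, Matrix.sum_apply]

theorem blk_mulVec (M : Matrix (BlockIdx d) (BlockIdx e) ℝ) (x : BlockIdx e → ℝ) (i : Fin k) :
    (fun a => (M *ᵥ x) ⟨i, a⟩) = ∑ j, blk M i j *ᵥ fun b => x ⟨j, b⟩ := by
  ext a
  simp only [mulVec, dotProduct, Fintype.sum_sigma, Finset.sum_apply]
  rfl

theorem blk_matDeriv (M : ℝ → Matrix (BlockIdx d) (BlockIdx e) ℝ) (T : Set ℝ) (t : ℝ) (i : Fin k)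
    (j : Fin l) : blk (matDeriv M T t) i j = matDeriv (fun s => blk (M s) i j) T t :=
  rfl

end Blocks

namespace IsCondensedForm

variable {d : Fin 6 → ℕ} {e : Fin 3 → ℕ} {c : LTVSystem (BlockIdx d) (BlockIdx e)} {T : Set ℝ}
  {t : ℝ}

theorem blk_E_mul_K (hc : IsCondensedForm c T) (ht : t ∈ T) {i j : Fin 6} (hij : 2 ≤ i ∨ 4 ≤ j) :
    blk (c.E t * c.K t) i j = 0 := by
  rw [blk_mul]
  refine Finset.sum_eq_zero fun r _ => ?_
  obtain hi | hj := hij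
  · rw [hc.E_pattern t ht i r ((patternE_eq_zero_iff i r).2 (.inl hi)), Matrix.zero_mul]
  · rw [hc.K_pattern t ht r j ((patternK_eq_zero_iff r j).2 (.inr hj)), Matrix.mul_zero]

theorem blk_A (hc : IsCondensedForm c T) (ht : t ∈ T) {i j : Fin 6} (hij : 2 ≤ i ∨ 4 ≤ j) :
    blk (c.A t) i j = blk (c.J t) i j - blk (c.R t) i j := by
  rw [LTVSystem.A, blk_sub, blk_sub, hc.blk_E_mul_K ht hij, sub_zero]

theorem blk_A_eq_blk_J (hc : IsCondensedForm c T) (ht : t ∈ T) {i j : Fin 6}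
    (hij : 4 ≤ i ∨ 4 ≤ j) : blk (c.A t) i j = blk (c.J t) i j := by
  rw [hc.blk_A ht (by omega), hc.R_pattern t ht i j ((patternR_eq_zero_iff i j).2 (by omega)),
    sub_zero]

theorem blk_A_eq_zero (hc : IsCondensedForm c T) (ht : t ∈ T) {i j : Fin 6} (hi : 4 ≤ i)
    (hij : 5 ≤ (i : ℕ) + j) : blk (c.A t) i j = 0 := by
  rw [hc.blk_A_eq_blk_J ht (.inl hi), hc.J_pattern t ht i j ((patternJ_eq_zero_iff i j).2 hij)]

theorem blk_J_four_zero (hc : IsCondensedForm c T) (hs : c.IsPHDAE T) (ht : t ∈ T) :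
    blk (c.J t) 4 0 = -(blk (c.J t) 0 4)ᵀ := by
  have hE : blk (matDeriv c.E T t) 4 0 = 0 := by
    rw [blk_matDeriv, matDeriv_congr (N := fun _ => 0) (fun s hs => hc.E_pattern s hs 4 0 rfl) ht,
      matDeriv_const]
  have hskew := congrArg (blk · 4 0) (hs.skew_adjoint t ht)
  have hblk : blk (c.E t * c.K t - c.J t + (c.E t * c.K t - c.J t)ᵀ) 4 0 =
      blk (c.E t * c.K t) 4 0 - blk (c.J t) 4 0 +
        (blk (c.E t * c.K t) 0 4 - blk (c.J t) 0 4)ᵀ := rfl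
  rw [hE, hblk, hc.blk_E_mul_K ht (by decide), hc.blk_E_mul_K ht (by decide), zero_sub, zero_sub,
    transpose_neg, eq_comm, ← sub_eq_add_neg, sub_eq_zero] at hskew
  rw [← hskew, neg_neg]

variable {z w : ℝ → BlockIdx d → ℝ} {u : ℝ → BlockIdx e → ℝ}

theorem sum_blk_eq_zero (hc : IsCondensedForm c T) (hz : c.IsStateSolution T z u) (ht : t ∈ T)
    {i : Fin 6} (hi : 2 ≤ i) :
    ∑ j, blk (c.A t) i j *ᵥ (fun b => z t ⟨j, b⟩) +
      ∑ j, blk (c.G t) i j *ᵥ (fun b => u t ⟨j, b⟩) = 0 := by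
  have hE : (fun a => (c.E t *ᵥ derivWithin z T t) ⟨i, a⟩) = 0 := by
    rw [blk_mulVec]
    refine Finset.sum_eq_zero fun j _ => ?_
    rw [hc.E_pattern t ht i j ((patternE_eq_zero_iff i j).2 (.inl hi)), zero_mulVec]
  rw [← blk_mulVec, ← blk_mulVec, ← hE, hz.2 t ht]
  rfl

theorem input_two_eq_zero (hc : IsCondensedForm c T) (hz : c.IsStateSolution T z u) (ht : t ∈ T) :
    (fun a => u t ⟨2, a⟩) = 0 := by
  have hrow := hc.sum_blk_eq_zero hz ht (i := 5) (by decide)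
  rw [Finset.sum_eq_zero fun j _ => by
      rw [hc.blk_A_eq_zero ht (by decide) (Nat.le_add_right _ _), zero_mulVec],
    Fin.sum_univ_three, hc.G_pattern t ht 5 0 rfl, hc.G_pattern t ht 5 1 rfl, zero_mulVec,
    zero_mulVec, zero_add, zero_add, zero_add] at hrow
  exact (hc.G63_inv t ht).eq_zero_of_mulVec hrow

theorem state_zero_eq_zero (hc : IsCondensedForm c T) (hs : c.IsPHDAE T)
    (hz : c.IsStateSolution T z u) (ht : t ∈ T) : (fun a => z t ⟨0, a⟩) = 0 := by
  have hrow := hc.sum_blk_eq_zero hz ht (i := 4) (by decide)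
  rw [Fin.sum_univ_succ, Finset.sum_eq_zero fun j _ => by
      rw [hc.blk_A_eq_zero ht (by decide) (by simp; omega), zero_mulVec],
    Fin.sum_univ_three, hc.G_pattern t ht 4 0 rfl, hc.G_pattern t ht 4 1 rfl,
    hc.input_two_eq_zero hz ht, zero_mulVec, zero_mulVec, mulVec_zero, add_zero, add_zero, add_zero,
    add_zero, hc.blk_A_eq_blk_J ht (by decide), hc.blk_J_four_zero hs ht] at hrow
  exact (hc.J15_inv t ht).neg_transpose.eq_zero_of_mulVec hrow

theorem E_mulVec_derivWithin_eq (hc : IsCondensedForm c T) (hz : ContDiffOn ℝ 1 z T)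
    (hw : ContDiffOn ℝ 1 w T) (hzw : ∀ t ∈ T, ∀ i, i ≠ 4 → ∀ a, z t ⟨i, a⟩ = w t ⟨i, a⟩)
    (ht : t ∈ T) : c.E t *ᵥ derivWithin z T t = c.E t *ᵥ derivWithin w T t := by
  have hderiv (j : Fin 6) (hj : j ≠ 4) (b : Fin (d j)) :
      derivWithin z T t ⟨j, b⟩ = derivWithin w T t ⟨j, b⟩ := by
    rw [derivWithin_pi fun x => (contDiffOn_pi.1 hz x).differentiableOn one_ne_zero t ht,
      derivWithin_pi fun x => (contDiffOn_pi.1 hw x).differentiableOn one_ne_zero t ht]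
    exact derivWithin_congr (fun s hs => hzw s hs j hj b) (hzw t ht j hj b)
  have hE (i : Fin 6) : blk (c.E t) i 4 = 0 :=
    hc.E_pattern t ht i 4 ((patternE_eq_zero_iff i 4).2 (.inr (by decide)))
  ext ⟨i, a⟩
  simp only [mulVec, dotProduct]
  refine Finset.sum_congr rfl fun x _ => ?_
  obtain ⟨j, b⟩ := x
  obtain rfl | hj := eq_or_ne j 4
  · change blk (c.E t) i 4 a b * _ = blk (c.E t) i 4 a b * _
    rw [hE, Matrix.zero_apply, zero_mul, zero_mul]
  · rw [hderiv j hj]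

theorem eqOn_of_eqOn_of_ne_four (hc : IsCondensedForm c T) (hz : c.IsStateSolution T z u)
    (hw : c.IsStateSolution T w u)
    (hzw : ∀ t ∈ T, ∀ i, i ≠ 4 → ∀ a, z t ⟨i, a⟩ = w t ⟨i, a⟩) : Set.EqOn z w T := by
  intro t ht
  have hoff (i : Fin 6) (hi : i ≠ 4) : (fun b => (z t - w t) ⟨i, b⟩) = 0 :=
    funext fun b => sub_eq_zero.2 (hzw t ht i hi b)
  have hA : c.A t *ᵥ (z t - w t) = 0 := by
    have h := hc.E_mulVec_derivWithin_eq hz.1 hw.1 hzw ht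
    rwa [hz.2 t ht, hw.2 t ht, add_left_inj, ← sub_eq_zero, ← mulVec_sub] at h
  have hrow : (fun a => (c.A t *ᵥ (z t - w t)) ⟨0, a⟩) = 0 := by rw [hA]; rfl
  rw [blk_mulVec, Finset.sum_eq_single 4 (fun i _ hi => by rw [hoff i hi, mulVec_zero])
    (fun h => absurd (Finset.mem_univ _) h), hc.blk_A_eq_blk_J ht (by decide)] at hrow
  have h4 := (hc.J15_inv t ht).eq_zero_of_mulVec hrow
  ext ⟨i, b⟩
  obtain rfl | hi := eq_or_ne i 4
  · exact sub_eq_zero.1 (congrFun h4 b)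
  · exact hzw t ht i hi b

end IsCondensedForm

section BlockCols

variable {k : ℕ} {d : Fin k → ℕ} {n : Type}

/-- The matrix `[F 0, …, F (k - 1)]` with the given blocks of columns. -/
def blockCols (F : ∀ i, Matrix n (Fin (d i)) ℝ) : Matrix n (BlockIdx d) ℝ :=
  of fun a x => F x.1 a x.2

theorem matC1On_blockCols {F : ∀ i, ℝ → Matrix n (Fin (d i)) ℝ} {T : Set ℝ}
    (hF : ∀ i, MatC1On (F i) T) : MatC1On (fun t => blockCols (F · t)) T :=
  fun a x => hF x.1 a x.2

theorem blockCols_mul_transpose (F : ∀ i, Matrix n (Fin (d i)) ℝ) :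
    blockCols F * (blockCols F)ᵀ = ∑ i, F i * (F i)ᵀ := by
  ext a b
  simp only [blockCols, mul_apply, transpose_apply, of_apply, Fintype.sum_sigma,
    Matrix.sum_apply]

variable [Fintype n] [DecidableEq n] {F : ∀ i, Matrix n (Fin (d i)) ℝ} {P : Fin k → Matrix n n ℝ}

theorem blockCols_mul_transpose_of_isFrame (hF : ∀ i, IsFrame (F i) (P i)) (hP : ∑ i, P i = 1) :
    blockCols F * (blockCols F)ᵀ = 1 := by
  rw [blockCols_mul_transpose, ← hP]
  exact Finset.sum_congr rfl fun i _ => (hF i).mul_transpose_self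

theorem card_blockIdx_of_isFrame (hF : ∀ i, IsFrame (F i) (P i)) (hP : ∑ i, P i = 1) :
    Fintype.card (BlockIdx d) = Fintype.card n := by
  have htrace (i : Fin k) : (P i).trace = d i := by
    rw [← (hF i).mul_transpose_self, trace_mul_comm, (hF i).transpose_mul_self, trace_one,
      Fintype.card_fin]
  have hsum := congrArg Matrix.trace hP
  rw [trace_sum, Finset.sum_congr rfl fun i _ => htrace i, trace_one, ← Nat.cast_sum,
    Nat.cast_inj] at hsum
  rw [← hsum, Fintype.card_sigma]
  simp only [Fintype.card_fin]

theorem transpose_blockCols_mul_of_isFrame (hF : ∀ i, IsFrame (F i) (P i)) (hP : ∑ i, P i = 1) :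
    (blockCols F)ᵀ * blockCols F = 1 :=
  (mul_eq_one_comm_of_card_eq _ _ _ (card_blockIdx_of_isFrame hF hP).symm).1
    (blockCols_mul_transpose_of_isFrame hF hP)

end BlockCols

namespace LTVSystem

section Transform

variable {n m k l : Type} [Fintype n] [Fintype m]

/-- The system satisfied by `ẑ = Vᵀ z`, `û = Uᵀ u`, `ŷ = Uᵀ y` for pointwise orthogonal `V`, `U`;
the derivative of `V` is absorbed in `K`. -/
noncomputable def transform (s : LTVSystem n m) (V : ℝ → Matrix n k ℝ) (U : ℝ → Matrix m l ℝ)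
    (T : Set ℝ) : LTVSystem k l where
  E t := (V t)ᵀ * s.E t * V t
  J t := (V t)ᵀ * s.J t * V t
  R t := (V t)ᵀ * s.R t * V t
  K t := (V t)ᵀ * s.K t * V t + (V t)ᵀ * matDeriv V T t
  G t := (V t)ᵀ * s.G t * U t

variable {s : LTVSystem n m} {V : ℝ → Matrix n k ℝ} {U : ℝ → Matrix m l ℝ} {T : Set ℝ}
  {t : ℝ}

variable [DecidableEq n] [Fintype k]

theorem transform_E_mul_K (hV : V t * (V t)ᵀ = 1) :
    (s.transform V U T).E t * (s.transform V U T).K t =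
      (V t)ᵀ * (s.E t * s.K t) * V t + (V t)ᵀ * s.E t * matDeriv V T t := by
  have hcancel {q : Type} (X : Matrix n q ℝ) : V t * ((V t)ᵀ * X) = X := by
    rw [← Matrix.mul_assoc, hV, Matrix.one_mul]
  simp only [transform, Matrix.mul_add, Matrix.mul_assoc, hcancel]

theorem transform_A (hV : V t * (V t)ᵀ = 1) : (s.transform V U T).A t =
    (V t)ᵀ * s.A t * V t - (V t)ᵀ * s.E t * matDeriv V T t := by
  rw [A, transform_E_mul_K hV, A, Matrix.mul_sub, Matrix.mul_sub, Matrix.sub_mul, Matrix.sub_mul,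
    sub_add_eq_sub_sub]
  rfl

theorem IsPHDAE.transform_skew_adjoint (hs : s.IsPHDAE T) (hV : MatC1On V T) (ht : t ∈ T)
    (hVo : V t * (V t)ᵀ = 1) :
    matDeriv (s.transform V U T).E T t =
      ((s.transform V U T).E t * (s.transform V U T).K t - (s.transform V U T).J t) +
        ((s.transform V U T).E t * (s.transform V U T).K t - (s.transform V U T).J t)ᵀ := by
  rw [transform_E_mul_K hVo]
  simp only [transform]
  rw [matDeriv_mul (hV.transpose.mul hs.E_C1) hV ht, matDeriv_mul hV.transpose hs.E_C1 ht,
    matDeriv_transpose, hs.skew_adjoint t ht]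
  simp only [transpose_add, transpose_sub, transpose_mul, transpose_transpose, hs.E_symm t ht,
    Matrix.mul_add, Matrix.add_mul, Matrix.mul_sub, Matrix.sub_mul, Matrix.mul_assoc]
  abel

theorem IsPHDAE.transform (hT : UniqueDiffOn ℝ T) (hs : s.IsPHDAE T) (hV : MatC1On V T)
    (hU : ContinuousOn U T) (hVo : ∀ t ∈ T, V t * (V t)ᵀ = 1) :
    (s.transform V U T).IsPHDAE T where
  E_C1 := (hV.transpose.mul hs.E_C1).mul hV
  J_cont := continuousOn_matrix_mul
    (continuousOn_matrix_mul hV.transpose.continuousOn hs.J_cont) hV.continuousOn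
  R_cont := continuousOn_matrix_mul
    (continuousOn_matrix_mul hV.transpose.continuousOn hs.R_cont) hV.continuousOn
  K_cont := (continuousOn_matrix_mul
    (continuousOn_matrix_mul hV.transpose.continuousOn hs.K_cont) hV.continuousOn).add
    (continuousOn_matrix_mul hV.transpose.continuousOn (hV.continuousOn_matDeriv hT))
  G_cont := continuousOn_matrix_mul
    (continuousOn_matrix_mul hV.transpose.continuousOn hs.G_cont) hU
  E_symm t ht := by
    simp only [LTVSystem.transform, transpose_mul, transpose_transpose, hs.E_symm t ht,
      Matrix.mul_assoc]
  skew_adjoint t ht := hs.transform_skew_adjoint hV ht (hVo t ht)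
  R_psd t ht := by
    have hR := (hs.R_psd t ht).conjTranspose_mul_mul_same (V t)
    rwa [conjTranspose_eq_transpose_of_trivial] at hR

end Transform

section CompressK

variable {n m : Type} [Fintype n]

/-- The system with `K` replaced by its compression `P K P`, where `J` is changed so that the
state coefficient `J - R - E K` and `E K - J` remain the same. -/
def compressK (s : LTVSystem n m) (P : Matrix n n ℝ) : LTVSystem n m where
  E := s.E
  J t := s.J t - s.E t * s.K t + s.E t * (P * s.K t * P)
  R := s.R
  K t := P * s.K t * P
  G := s.G

variable {s : LTVSystem n m} {T : Set ℝ} {t : ℝ} {P : Matrix n n ℝ}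

theorem compressK_A : (s.compressK P).A t = s.A t := by
  simp only [A, compressK]
  abel

theorem IsPHDAE.compressK (hs : s.IsPHDAE T) (P : Matrix n n ℝ) : (s.compressK P).IsPHDAE T where
  E_C1 := hs.E_C1
  J_cont := (hs.J_cont.sub (continuousOn_matrix_mul hs.E_C1.continuousOn hs.K_cont)).add
    (continuousOn_matrix_mul hs.E_C1.continuousOn (continuousOn_matrix_mul
      (continuousOn_matrix_mul continuousOn_const hs.K_cont) continuousOn_const))
  R_cont := hs.R_cont
  K_cont := continuousOn_matrix_mul
    (continuousOn_matrix_mul continuousOn_const hs.K_cont) continuousOn_const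
  G_cont := hs.G_cont
  E_symm := hs.E_symm
  skew_adjoint t ht := by
    have hEK : (s.compressK P).E t * (s.compressK P).K t - (s.compressK P).J t =
        s.E t * s.K t - s.J t := by
      simp only [LTVSystem.compressK]
      abel
    rw [hEK]
    exact hs.skew_adjoint t ht
  R_psd := hs.R_psd

variable [DecidableEq n]

theorem IsPHDAE.compressK_J (hs : s.IsPHDAE T) (hP : ∀ t ∈ T, s.E t * P = s.E t) (ht : t ∈ T) :
    (s.compressK P).J t = s.J t * P - (s.J t)ᵀ * (1 - P) := by
  have hE (t : ℝ) (ht : t ∈ T) : s.E t * (1 - P) = 0 := by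
    rw [mul_sub, mul_one, hP t ht, sub_self]
  have hEdot : matDeriv s.E T t * (1 - P) = 0 := by
    have h := matDeriv_congr (N := fun _ => 0) hE ht
    rwa [matDeriv_mul hs.E_C1 (.const _ T) ht, matDeriv_const, matDeriv_const, mul_zero,
      add_zero] at h
  have hEK : s.E t * s.K t * (1 - P) = (s.J t + (s.J t)ᵀ) * (1 - P) := by
    rw [hs.skew_adjoint t ht, transpose_sub, transpose_mul, hs.E_symm t ht] at hEdot
    have hexpand : (s.E t * s.K t - s.J t + ((s.K t)ᵀ * s.E t - (s.J t)ᵀ)) * (1 - P) =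
        s.E t * s.K t * (1 - P) + (s.K t)ᵀ * (s.E t * (1 - P)) -
          (s.J t + (s.J t)ᵀ) * (1 - P) := by noncomm_ring
    rwa [hexpand, hE t ht, mul_zero, add_zero, sub_eq_zero] at hEdot
  calc (s.compressK P).J t
    _ = s.J t - s.E t * s.K t + s.E t * (P * s.K t * P) := rfl
    _ = s.J t - s.E t * s.K t * (1 - P) := by
      rw [← mul_assoc, ← mul_assoc, hP t ht]
      noncomm_ring
    _ = s.J t * P - (s.J t)ᵀ * (1 - P) := by
      rw [hEK]
      noncomm_ring

end CompressK

theorem IsPHDAE.isCongruent_compressK_transform {n m k l : Type} [Fintype n] [DecidableEq n]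
    [Fintype m] [Fintype k] [Fintype l] {s : LTVSystem n m} {V : ℝ → Matrix n k ℝ}
    {U : ℝ → Matrix m l ℝ} {T : Set ℝ} {P : Matrix k k ℝ}
    (hs : (s.transform V U T).IsPHDAE T) (hV : ∀ t ∈ T, V t * (V t)ᵀ = 1)
    (hP : ∀ t ∈ T, (s.transform V U T).E t * P = (s.transform V U T).E t) :
    IsCongruent s ((s.transform V U T).compressK P) V U T where
  E_eq _ _ := rfl
  R_eq _ _ := rfl
  A_eq t ht := by rw [compressK_A, transform_A (hV t ht)]
  G_eq _ _ := rfl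
  J_eq_of_skew hskew t ht := by
    classical
    have hJ : ((s.transform V U T).J t)ᵀ = -(s.transform V U T).J t := by
      simp only [LTVSystem.transform, transpose_mul, transpose_transpose, hskew t ht,
        Matrix.mul_neg, Matrix.neg_mul, Matrix.mul_assoc]
    rw [hs.compressK_J hP ht, hJ, neg_mul, sub_neg_eq_add, ← mul_add, add_sub_cancel, mul_one]
    rfl

section Condensation

variable {d : Fin 6 → ℕ} {n m : Type} [Fintype n] [DecidableEq n]

/-- The projection onto the first two of the six state blocks, the only ones on which the `E` of a
condensed form acts. -/
def leadProj (d : Fin 6 → ℕ) : Matrix (BlockIdx d) (BlockIdx d) ℝ :=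
  diagonal fun x => if x.1 < 2 then 1 else 0

theorem mul_leadProj_of_blk_eq_zero {M : Matrix (BlockIdx d) (BlockIdx d) ℝ}
    (hM : ∀ i j, 2 ≤ j → blk M i j = 0) : M * leadProj d = M := by
  ext x y
  rw [leadProj, mul_diagonal]
  split_ifs with hy
  · rw [mul_one]
  · exact (mul_zero _).trans (congrFun₂ (hM x.1 y.1 (not_lt.1 hy)) x.2 y.2).symm

theorem blk_leadProj_mul_mul_leadProj (M : Matrix (BlockIdx d) (BlockIdx d) ℝ) {i j : Fin 6}
    (hij : 2 ≤ i ∨ 2 ≤ j) : blk (leadProj d * M * leadProj d) i j = 0 := by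
  ext a b
  rw [blk, of_apply, leadProj, mul_diagonal, diagonal_mul, Matrix.zero_apply]
  obtain hi | hj := hij
  · rw [if_neg (not_lt.2 hi), zero_mul, zero_mul]
  · rw [if_neg (not_lt.2 hj), mul_zero]

theorem IsPHDAE.blk_compressK_leadProj_J {m : Type} {s : LTVSystem (BlockIdx d) m} {T : Set ℝ}
    {t : ℝ} (hs : s.IsPHDAE T) (hE : ∀ t ∈ T, s.E t * leadProj d = s.E t) (ht : t ∈ T)
    (i j : Fin 6) :
    blk ((s.compressK (leadProj d)).J t) i j =
      if j < 2 then blk (s.J t) i j else -(blk (s.J t) j i)ᵀ := by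
  ext a b
  rw [hs.compressK_J hE ht, mul_sub, mul_one, leadProj]
  simp only [blk, of_apply, Matrix.sub_apply, mul_diagonal, transpose_apply]
  split_ifs
  · rw [mul_one, mul_one, sub_self, sub_zero, of_apply]
  · rw [mul_zero, mul_zero, sub_zero, zero_sub]
    rfl

variable [Fintype m] {s : LTVSystem n m} {t : ℝ} {p : StaircaseProj n m}
  {F : ∀ i, Matrix n (Fin (d i)) ℝ}

theorem IsStaircase.conj_E_eq_zero (h : s.IsStaircase t p)
    (hF : ∀ i, IsFrame (F i) (p.stateProj i)) {i j : Fin 6} (hij : 2 ≤ i ∨ 2 ≤ j) :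
    (F i)ᵀ * s.E t * F j = 0 := by
  refine (hF i).conj_eq_zero (hF j) ?_
  obtain hi | hj := hij
  · have hE := congrArg Matrix.transpose (h.E_mul_stateProj hi)
    rw [transpose_mul, h.E_symm, h.transpose_stateProj, transpose_zero] at hE
    rw [hE, zero_mul]
  · rw [mul_assoc, h.E_mul_stateProj hj, mul_zero]

theorem IsStaircase.conj_R_eq_zero (h : s.IsStaircase t p)
    (hF : ∀ i, IsFrame (F i) (p.stateProj i)) {i j : Fin 6} (hij : 3 ≤ i ∨ 3 ≤ j) :
    (F i)ᵀ * s.R t * F j = 0 := by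
  refine (hF i).conj_eq_zero (hF j) ?_
  obtain hi | hj := hij
  · have hR := congrArg Matrix.transpose (h.R_mul_stateProj hi)
    rw [transpose_mul, h.R_symm, h.transpose_stateProj, transpose_zero] at hR
    rw [hR, zero_mul]
  · rw [mul_assoc, h.R_mul_stateProj hj, mul_zero]

theorem IsStaircase.conj_J_eq_zero (h : s.IsStaircase t p)
    (hF : ∀ i, IsFrame (F i) (p.stateProj i)) {i j : Fin 6} (hi : 2 ≤ i)
    (hij : 5 ≤ (i : ℕ) + j) : (F i)ᵀ * s.J t * F j = 0 :=
  (hF i).conj_eq_zero (hF j)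
    (h.stateProj_mul_J_mul_stateProj hi ((patternJ_eq_zero_iff i j).2 hij))

theorem IsStaircase.conj_J_two_two (h : s.IsStaircase t p)
    (hF : ∀ i, IsFrame (F i) (p.stateProj i)) :
    -((F 2)ᵀ * s.J t * F 2)ᵀ = (F 2)ᵀ * s.J t * F 2 := by
  have hPJP : p.stateProj 2 * (s.J t + (s.J t)ᵀ) * p.stateProj 2 = 0 := by
    have hPE := congrArg (p.stateProj 2 * · * p.stateProj 2) h.PE_mul_J_mul_PE
    simpa only [← mul_assoc, h.stateProj_mul_PE (i := 2) le_rfl, mul_assoc _ p.PE,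
      h.PE_mul_stateProj (i := 2) le_rfl, mul_zero, zero_mul] using hPE
  have hsum := (hF 2).conj_eq_zero (hF 2) hPJP
  rw [Matrix.mul_add, Matrix.add_mul] at hsum
  rw [transpose_mul, transpose_mul, transpose_transpose, ← Matrix.mul_assoc,
    eq_neg_of_add_eq_zero_left hsum]

end Condensation

section Condense

variable {d : Fin 6 → ℕ} {e : Fin 3 → ℕ} {n m : Type} [Fintype n] [Fintype m]

/-- The condensed form of `s` in the moving coordinates given by the columns of `F 0, …, F 5` for
the state and of `H 0, H 1, H 2` for the input. -/
noncomputable def condense (s : LTVSystem n m) (F : ∀ i, ℝ → Matrix n (Fin (d i)) ℝ)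
    (H : ∀ j, ℝ → Matrix m (Fin (e j)) ℝ) (T : Set ℝ) : LTVSystem (BlockIdx d) (BlockIdx e) :=
  (s.transform (fun t => blockCols (F · t)) (fun t => blockCols (H · t)) T).compressK (leadProj d)

variable [DecidableEq n] {s : LTVSystem n m} {T : Set ℝ} {p : ℝ → StaircaseProj n m}
  {F : ∀ i, ℝ → Matrix n (Fin (d i)) ℝ} {H : ∀ j, ℝ → Matrix m (Fin (e j)) ℝ}

theorem transform_E_mul_leadProj (hstair : ∀ t ∈ T, s.IsStaircase t (p t))
    (hF : ∀ i, ∀ t ∈ T, IsFrame (F i t) ((p t).stateProj i)) {t : ℝ} (ht : t ∈ T) :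
    (s.transform (fun t => blockCols (F · t)) (fun t => blockCols (H · t)) T).E t * leadProj d =
      (s.transform (fun t => blockCols (F · t)) (fun t => blockCols (H · t)) T).E t :=
  mul_leadProj_of_blk_eq_zero fun _ _ hj =>
    (hstair t ht).conj_E_eq_zero (fun i => hF i t ht) (.inr hj)

theorem IsPHDAE.transform_blockCols (hT : UniqueDiffOn ℝ T) (hs : s.IsPHDAE T)
    (hF : ∀ i, ∀ t ∈ T, IsFrame (F i t) ((p t).stateProj i)) (hFC1 : ∀ i, MatC1On (F i) T)
    (hHC1 : ∀ j, MatC1On (H j) T) :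
    (s.transform (fun t => blockCols (F · t)) (fun t => blockCols (H · t)) T).IsPHDAE T :=
  hs.transform hT (matC1On_blockCols hFC1) (matC1On_blockCols hHC1).continuousOn fun t ht =>
    blockCols_mul_transpose_of_isFrame (fun i => hF i t ht) (p t).sum_stateProj

theorem IsPHDAE.condense (hT : UniqueDiffOn ℝ T) (hs : s.IsPHDAE T)
    (hF : ∀ i, ∀ t ∈ T, IsFrame (F i t) ((p t).stateProj i)) (hFC1 : ∀ i, MatC1On (F i) T)
    (hHC1 : ∀ j, MatC1On (H j) T) : (s.condense F H T).IsPHDAE T :=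
  (hs.transform_blockCols hT hF hFC1 hHC1).compressK _

theorem IsPHDAE.isCongruent_condense (hT : UniqueDiffOn ℝ T) (hs : s.IsPHDAE T)
    (hstair : ∀ t ∈ T, s.IsStaircase t (p t))
    (hF : ∀ i, ∀ t ∈ T, IsFrame (F i t) ((p t).stateProj i)) (hFC1 : ∀ i, MatC1On (F i) T)
    (hHC1 : ∀ j, MatC1On (H j) T) :
    IsCongruent s (s.condense F H T) (fun t => blockCols (F · t)) (fun t => blockCols (H · t)) T :=
  (hs.transform_blockCols hT hF hFC1 hHC1).isCongruent_compressK_transform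
    (fun t ht => blockCols_mul_transpose_of_isFrame (fun i => hF i t ht) (p t).sum_stateProj)
    fun _ => transform_E_mul_leadProj hstair hF

theorem IsPHDAE.blk_condense_J (hT : UniqueDiffOn ℝ T) (hs : s.IsPHDAE T)
    (hstair : ∀ t ∈ T, s.IsStaircase t (p t))
    (hF : ∀ i, ∀ t ∈ T, IsFrame (F i t) ((p t).stateProj i)) (hFC1 : ∀ i, MatC1On (F i) T)
    (hHC1 : ∀ j, MatC1On (H j) T) {t : ℝ} (ht : t ∈ T) (i j : Fin 6) :
    blk ((s.condense F H T).J t) i j =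
      if j < 2 then (F i t)ᵀ * s.J t * F j t else -((F j t)ᵀ * s.J t * F i t)ᵀ :=
  (hs.transform_blockCols hT hF hFC1 hHC1).blk_compressK_leadProj_J
    (fun _ => transform_E_mul_leadProj hstair hF) ht i j

theorem IsPHDAE.hasPattern_condense_J (hT : UniqueDiffOn ℝ T) (hs : s.IsPHDAE T)
    (hstair : ∀ t ∈ T, s.IsStaircase t (p t))
    (hF : ∀ i, ∀ t ∈ T, IsFrame (F i t) ((p t).stateProj i)) (hFC1 : ∀ i, MatC1On (F i) T)
    (hHC1 : ∀ j, MatC1On (H j) T) {t : ℝ} (ht : t ∈ T) :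
    HasPattern ((s.condense F H T).J t) patternJ := by
  intro i j hij
  rw [patternJ_eq_zero_iff] at hij
  rw [hs.blk_condense_J hT hstair hF hFC1 hHC1 ht]
  split_ifs with hj
  · exact (hstair t ht).conj_J_eq_zero (fun i => hF i t ht) (by omega) hij
  · rw [(hstair t ht).conj_J_eq_zero (fun i => hF i t ht) (not_lt.1 hj) (by omega),
      transpose_zero, neg_zero]

theorem IsPHDAE.isInvertibleMatrix_condense_JR (hT : UniqueDiffOn ℝ T) (hs : s.IsPHDAE T)
    (hstair : ∀ t ∈ T, s.IsStaircase t (p t))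
    (hF : ∀ i, ∀ t ∈ T, IsFrame (F i t) ((p t).stateProj i)) (hFC1 : ∀ i, MatC1On (F i) T)
    (hHC1 : ∀ j, MatC1On (H j) T) {t : ℝ} (ht : t ∈ T) :
    IsInvertibleMatrix (blk ((s.condense F H T).J t - (s.condense F H T).R t) 2 2) := by
  have hR : blk ((s.condense F H T).R t) 2 2 = (F 2 t)ᵀ * s.R t * F 2 t := rfl
  rw [blk_sub, hs.blk_condense_J hT hstair hF hFC1 hHC1 ht, if_neg (by decide), hR,
    (hstair t ht).conj_J_two_two fun i => hF i t ht, ← Matrix.sub_mul, ← Matrix.mul_sub]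
  exact (hstair t ht).isInvertibleMatrix_conj_JR (hF 2 t ht)

theorem IsPHDAE.isCondensedForm_condense [DecidableEq m] (hT : UniqueDiffOn ℝ T) (hs : s.IsPHDAE T)
    (hH : ∀ t ∈ T, ∀ z, 0 ≤ s.hamiltonian t z) (hstair : ∀ t ∈ T, s.IsStaircase t (p t))
    (hF : ∀ i, ∀ t ∈ T, IsFrame (F i t) ((p t).stateProj i)) (hFC1 : ∀ i, MatC1On (F i) T)
    (hHframe : ∀ j, ∀ t ∈ T, IsFrame (H j t) ((p t).inputProj j))
    (hHC1 : ∀ j, MatC1On (H j) T) : IsCondensedForm (s.condense F H T) T where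
  E_pattern t ht i j hij :=
    (hstair t ht).conj_E_eq_zero (fun i => hF i t ht) ((patternE_eq_zero_iff i j).1 hij)
  J_pattern _ ht := hs.hasPattern_condense_J hT hstair hF hFC1 hHC1 ht
  R_pattern t ht i j hij :=
    (hstair t ht).conj_R_eq_zero (fun i => hF i t ht) ((patternR_eq_zero_iff i j).1 hij)
  K_pattern t _ i j hij := blk_leadProj_mul_mul_leadProj _ <| by
    rw [patternK_eq_zero_iff] at hij
    omega
  G_pattern t ht i j hij :=
    (hF i t ht).conj_eq_zero (hHframe j t ht) ((hstair t ht).stateProj_mul_G_mul_inputProj hij)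
  E22_inv t ht := (hstair t ht).isInvertibleMatrix_conj_E (hH t ht) (hF 1 t ht)
  JR33_inv _ ht := hs.isInvertibleMatrix_condense_JR hT hstair hF hFC1 hHC1 ht
  J15_inv t ht := by
    rw [hs.blk_condense_J hT hstair hF hFC1 hHC1 ht, if_neg (by decide)]
    exact ((hstair t ht).isInvertibleMatrix_conj_J (hF 4 t ht) (hF 0 t ht)).neg_transpose
  G42_inv t ht := (hstair t ht).isInvertibleMatrix_conj_G_reached (hF 3 t ht) (hHframe 1 t ht)
  G63_inv t ht := (hstair t ht).isInvertibleMatrix_conj_G_annihilated (hF 5 t ht) (hHframe 2 t ht)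

end Condense

end LTVSystem

section Congruence

variable {n m n' m' : Type} [Fintype n] [Fintype m] [Fintype n'] [Fintype m'] [DecidableEq n]

theorem transpose_mulVec_inj {M : Matrix n n' ℝ} (hM : M * Mᵀ = 1) {x w : n → ℝ} :
    Mᵀ *ᵥ x = Mᵀ *ᵥ w ↔ x = w := by
  refine Function.Injective.eq_iff (f := (Mᵀ *ᵥ ·)) (Function.LeftInverse.injective
    (g := (M *ᵥ ·)) fun v => ?_)
  simp only [mulVec_mulVec, hM, one_mulVec]

variable [DecidableEq m] {s : LTVSystem n m} {c : LTVSystem n' m'}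
  {V : ℝ → Matrix n n' ℝ} {U : ℝ → Matrix m m' ℝ} {T : Set ℝ}

theorem IsCongruent.isStateSolution_iff (h : IsCongruent s c V U T) (hV : MatC1On V T)
    (hVV : ∀ t ∈ T, V t * (V t)ᵀ = 1) (hUU : ∀ t ∈ T, U t * (U t)ᵀ = 1) (z : ℝ → n → ℝ)
    (u : ℝ → m → ℝ) : s.IsStateSolution T z u ↔
      c.IsStateSolution T (fun t => (V t)ᵀ *ᵥ z t) (fun t => (U t)ᵀ *ᵥ u t) := by
  have hVz (t) (ht : t ∈ T) : z t = V t *ᵥ ((V t)ᵀ *ᵥ z t) := by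
    rw [mulVec_mulVec, hVV t ht, one_mulVec]
  have hC1 : ContDiffOn ℝ 1 z T ↔ ContDiffOn ℝ 1 (fun t => (V t)ᵀ *ᵥ z t) T :=
    ⟨fun hz => hV.transpose.mulVec hz, fun hz => (hV.mulVec hz).congr hVz⟩
  refine and_congr hC1 Iff.rfl |>.trans <| and_congr_right fun hz => forall₂_congr fun t ht => ?_
  have hderiv : derivWithin z T t = matDeriv V T t *ᵥ ((V t)ᵀ *ᵥ z t) +
      V t *ᵥ derivWithin (fun t => (V t)ᵀ *ᵥ z t) T t := by
    rw [← derivWithin_mulVec hV hz ht]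
    exact derivWithin_congr hVz (hVz t ht)
  have hA : ((V t)ᵀ * s.A t * V t) *ᵥ ((V t)ᵀ *ᵥ z t) = (V t)ᵀ *ᵥ (s.A t *ᵥ z t) := by
    rw [mulVec_mulVec, Matrix.mul_assoc, hVV t ht, Matrix.mul_one, mulVec_mulVec]
  have hG : ((V t)ᵀ * s.G t * U t) *ᵥ ((U t)ᵀ *ᵥ u t) = (V t)ᵀ *ᵥ (s.G t *ᵥ u t) := by
    rw [mulVec_mulVec, Matrix.mul_assoc, hUU t ht, Matrix.mul_one, mulVec_mulVec]
  rw [← transpose_mulVec_inj (hVV t ht), h.E_eq t ht, h.A_eq t ht, h.G_eq t ht, hG, sub_mulVec,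
    hA, hderiv, mulVec_add (s.E t), mulVec_add, mulVec_add]
  simp only [← mulVec_mulVec]
  rw [sub_add_eq_add_sub, eq_sub_iff_add_eq, add_comm]

theorem IsCongruent.isSolution_iff (h : IsCongruent s c V U T) (hV : MatC1On V T)
    (hVV : ∀ t ∈ T, V t * (V t)ᵀ = 1) (hUU : ∀ t ∈ T, U t * (U t)ᵀ = 1) (z : ℝ → n → ℝ)
    (u y : ℝ → m → ℝ) : s.IsSolution T z u y ↔
      c.IsSolution T (fun t => (V t)ᵀ *ᵥ z t) (fun t => (U t)ᵀ *ᵥ u t)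
        (fun t => (U t)ᵀ *ᵥ y t) := by
  refine and_congr (h.isStateSolution_iff hV hVV hUU z u) (forall₂_congr fun t ht => ?_)
  have hG : (c.G t)ᵀ *ᵥ ((V t)ᵀ *ᵥ z t) = (U t)ᵀ *ᵥ ((s.G t)ᵀ *ᵥ z t) := by
    simp only [h.G_eq t ht, mulVec_mulVec, ← transpose_mul, ← Matrix.mul_assoc, hVV t ht,
      Matrix.one_mul]
  rw [hG, transpose_mulVec_inj (hUU t ht)]

end Congruence

section Augment

variable {n₁ n₂ m : Type}

theorem fromBlocks_zero_mulVec_eq_zero_iff [Fintype n₁] [Fintype n₂] {M : Matrix n₁ n₁ ℝ}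
    {x : n₁ ⊕ n₂ → ℝ} :
    fromBlocks M 0 0 (0 : Matrix n₂ n₂ ℝ) *ᵥ x = 0 ↔ M *ᵥ (x ∘ Sum.inl) = 0 := by
  simp only [fromBlocks_mulVec, zero_mulVec, add_zero]
  rw [← Sum.elim_zero_zero, Sum.elim_eq_iff]
  exact and_iff_left rfl

theorem eq_zero_of_transpose_mulVec_eq_zero [Fintype n₂] [Fintype m] {G : Matrix n₂ m ℝ}
    (h : G.rank = Fintype.card n₂) {x : n₂ → ℝ} (hx : Gᵀ *ᵥ x = 0) : x = 0 := by
  have hrank := LinearMap.finrank_range_add_finrank_ker Gᵀ.mulVecLin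
  rw [← Matrix.rank, rank_transpose, h, Module.finrank_pi] at hrank
  have hker : LinearMap.ker Gᵀ.mulVecLin = ⊥ := Submodule.finrank_eq_zero.1 (by lia)
  exact LinearMap.ker_eq_bot'.1 hker x hx

namespace LTVSystem

theorem IsPHDAE.of_augment [Fintype n₁] [Fintype n₂] {s : LTVSystem n₁ m}
    {G₂ : ℝ → Matrix n₂ m ℝ} {T : Set ℝ} (h : (s.augment G₂).IsPHDAE T) : s.IsPHDAE T where
  E_C1 i j := h.E_C1 (Sum.inl i) (Sum.inl j)
  J_cont := continuousOn_pi.2 fun i => continuousOn_pi.2 fun j =>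
    continuousOn_pi.1 (continuousOn_pi.1 h.J_cont (Sum.inl i)) (Sum.inl j)
  R_cont := continuousOn_pi.2 fun i => continuousOn_pi.2 fun j =>
    continuousOn_pi.1 (continuousOn_pi.1 h.R_cont (Sum.inl i)) (Sum.inl j)
  K_cont := continuousOn_pi.2 fun i => continuousOn_pi.2 fun j =>
    continuousOn_pi.1 (continuousOn_pi.1 h.K_cont (Sum.inl i)) (Sum.inl j)
  G_cont := continuousOn_pi.2 fun i => continuousOn_pi.1 h.G_cont (Sum.inl i)
  E_symm t ht := congrArg toBlocks₁₁ (h.E_symm t ht)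
  skew_adjoint t ht := by
    have hskew := congrArg toBlocks₁₁ (h.skew_adjoint t ht)
    simp only [augment, fromBlocks_multiply, Matrix.zero_mul, add_zero] at hskew
    exact hskew
  R_psd t ht := (h.R_psd t ht).submatrix Sum.inl

variable {n : Type} [Fintype n] [Fintype m]

theorem IsPHDAE.eqOn_zero_of_isRegular {s : LTVSystem n m} {t₀ t₁ : ℝ} (hab : t₀ < t₁)
    (hs : s.IsPHDAE (Set.Icc t₀ t₁)) (hreg : s.IsRegular t₀ t₁) {w : ℝ → n → ℝ}
    (hw : ContDiffOn ℝ 1 w (Set.Icc t₀ t₁))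
    (hE : ∀ t ∈ Set.Icc t₀ t₁, s.E t *ᵥ w t = 0) (hR : ∀ t ∈ Set.Icc t₀ t₁, s.R t *ᵥ w t = 0)
    (hJ : ∀ t ∈ Set.Icc t₀ t₁, (s.J t)ᵀ *ᵥ w t = 0) : Set.EqOn w 0 (Set.Icc t₀ t₁) := by
  obtain ⟨k, hk⟩ := hreg
  -- The factor `t - t₀` makes the initial value vanish, so that uniqueness applies.
  have hv : ContDiffOn ℝ 1 (fun t => (t - t₀) • w t) (Set.Icc t₀ t₁) :=
    (contDiffOn_id.sub contDiffOn_const).smul hw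
  have hvsol : s.IsStateSolution (Set.Icc t₀ t₁) (fun t => (t - t₀) • w t) 0 := by
    refine ⟨hv, fun t ht => ?_⟩
    rw [hs.E_mulVec_derivWithin hv (fun r hr => by rw [mulVec_smul, hE r hr, smul_zero])
      (fun r hr => by rw [mulVec_smul, hR r hr, smul_zero])
      (fun r hr => by rw [mulVec_smul, hJ r hr, smul_zero]) ht, Pi.zero_apply, mulVec_zero,
      add_zero]
  have hzero : s.IsStateSolution (Set.Icc t₀ t₁) 0 0 :=
    ⟨contDiffOn_const, fun t _ => by
      simp only [derivWithin_zero, Pi.zero_apply, mulVec_zero, add_zero]⟩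
  have hv0 := (hk 0 contDiffOn_const).2 _ _ hvsol hzero (by rw [sub_self, zero_smul]; rfl)
  have hIoc : Set.EqOn w 0 (Set.Ioc t₀ t₁) := fun t ht =>
    (smul_eq_zero.1 (hv0 (Set.Ioc_subset_Icc_self ht))).resolve_left (sub_ne_zero.2 ht.1.ne')
  exact hIoc.of_subset_closure hw.continuousOn continuousOn_const Set.Ioc_subset_Icc_self
    (closure_Ioc hab.ne).ge

variable [Fintype n₁] [Fintype n₂] {s : LTVSystem n₁ m} {G₂ : ℝ → Matrix n₂ m ℝ} {t₀ t₁ : ℝ}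

theorem IsPHDAE.comp_inl_eq_zero_of_mem_algKernel (hab : t₀ < t₁)
    (hpH : (s.augment G₂).IsPHDAE (Set.Icc t₀ t₁)) (hreg : s.IsRegular t₀ t₁)
    (hJ : MatC1On s.J (Set.Icc t₀ t₁)) (hR : MatC1On s.R (Set.Icc t₀ t₁))
    (hrank : (s.augment G₂).HasConstantRanks (Set.Icc t₀ t₁)) {t : ℝ} (ht : t ∈ Set.Icc t₀ t₁)
    {x : n₁ ⊕ n₂ → ℝ} (hx : x ∈ (s.augment G₂).algKernel t)
    (hJRx : ((s.augment G₂).J t - (s.augment G₂).R t)ᵀ *ᵥ x = 0) : x ∘ Sum.inl = 0 := by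
  obtain ⟨PE, _, PZ, hPE, _, hPZ, hPE', _, hPZ'⟩ := exists_isOrthProj_algKernel hpH.E_C1
    (hJ.fromBlocks_zero n₂ n₂) (hR.fromBlocks_zero n₂ n₂) hrank
  have hRw (r) (hr : r ∈ Set.Icc t₀ t₁) : (s.augment G₂).R r *ᵥ (PZ r *ᵥ x) = 0 :=
    hpH.R_mulVec_eq_zero hPE hPE' hr ((hPZ' r hr).mulVec_mem x).1
  have hJw (r) (hr : r ∈ Set.Icc t₀ t₁) : ((s.augment G₂).J r)ᵀ *ᵥ (PZ r *ᵥ x) = 0 := by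
    have h : ((s.augment G₂).J r - (s.augment G₂).R r)ᵀ *ᵥ (PZ r *ᵥ x) = 0 :=
      ((hPZ' r hr).mulVec_mem x).2
    rwa [transpose_sub, hpH.R_transpose hr, sub_mulVec, hRw r hr, sub_zero] at h
  have hcurve := hpH.of_augment.eqOn_zero_of_isRegular hab hreg
    (w := fun r => (PZ r *ᵥ x) ∘ Sum.inl)
    (contDiffOn_pi.2 fun i => contDiffOn_pi.1 (hPZ.mulVec contDiffOn_const) (Sum.inl i))
    (fun r hr => fromBlocks_zero_mulVec_eq_zero_iff.1 ((hPZ' r hr).mulVec_mem x).1.1)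
    (fun r hr => fromBlocks_zero_mulVec_eq_zero_iff.1 (hRw r hr))
    fun r hr => fromBlocks_zero_mulVec_eq_zero_iff (n₂ := n₂).1 <| by
      simpa only [augment, fromBlocks_transpose, transpose_zero] using hJw r hr
  have hinl : (PZ t *ᵥ x) ∘ Sum.inl = 0 := hcurve ht
  rwa [(hPZ' t ht).mulVec_eq_iff.2 ⟨hx, hJRx⟩] at hinl

theorem IsPHDAE.augment_eq_zero_of_mem_algKernel (hab : t₀ < t₁)
    (hpH : (s.augment G₂).IsPHDAE (Set.Icc t₀ t₁)) (hreg : s.IsRegular t₀ t₁)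
    (hJ : MatC1On s.J (Set.Icc t₀ t₁)) (hR : MatC1On s.R (Set.Icc t₀ t₁))
    (hrank : (s.augment G₂).HasConstantRanks (Set.Icc t₀ t₁)) {t : ℝ} (ht : t ∈ Set.Icc t₀ t₁)
    (hfull : (G₂ t).rank = Fintype.card n₂)
    {x : n₁ ⊕ n₂ → ℝ} (hx : x ∈ (s.augment G₂).algKernel t)
    (hJRx : ((s.augment G₂).J t - (s.augment G₂).R t)ᵀ *ᵥ x = 0)
    (hGx : ((s.augment G₂).G t)ᵀ *ᵥ x = 0) : x = 0 := by
  have hinl := hpH.comp_inl_eq_zero_of_mem_algKernel hab hreg hJ hR hrank ht hx hJRx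
  have hinr : x ∘ Sum.inr = 0 := eq_zero_of_transpose_mulVec_eq_zero hfull <| by
    rwa [augment, transpose_fromRows, fromCols_mulVec, hinl, mulVec_zero, zero_add] at hGx
  rw [← Sum.elim_comp_inl_inr x, hinl, hinr, Sum.elim_zero_zero]

end LTVSystem

end Augment

theorem mainTheorem5_general {t₀ t₁ : ℝ} (ht : t₀ < t₁) {n m : Type} [Fintype n] [DecidableEq n]
    [Fintype m] [DecidableEq m] {s : LTVSystem n m} (hs : s.IsPHDAE (Set.Icc t₀ t₁))
    (hH : ∀ t ∈ Set.Icc t₀ t₁, ∀ z, 0 ≤ s.hamiltonian t z)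
    (hJ : MatC1On s.J (Set.Icc t₀ t₁)) (hR : MatC1On s.R (Set.Icc t₀ t₁))
    (hG : MatC1On s.G (Set.Icc t₀ t₁)) (hrank : s.HasConstantRanks (Set.Icc t₀ t₁))
    (hinj : ∀ t ∈ Set.Icc t₀ t₁, ∀ x ∈ s.algKernel t,
      (s.J t - s.R t)ᵀ *ᵥ x = 0 → (s.G t)ᵀ *ᵥ x = 0 → x = 0) :
    ∃ (d : Fin 6 → ℕ) (e : Fin 3 → ℕ) (V : ℝ → Matrix n (BlockIdx d) ℝ)
      (U : ℝ → Matrix m (BlockIdx e) ℝ) (c : LTVSystem (BlockIdx d) (BlockIdx e)),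
      MatC1On V (Set.Icc t₀ t₁) ∧ IsOrthogonalOn V (Set.Icc t₀ t₁) ∧
      MatC1On U (Set.Icc t₀ t₁) ∧ IsOrthogonalOn U (Set.Icc t₀ t₁) ∧
      IsCongruent s c V U (Set.Icc t₀ t₁) ∧
      (∀ (z : ℝ → n → ℝ) (u y : ℝ → m → ℝ), s.IsSolution (Set.Icc t₀ t₁) z u y ↔
        c.IsSolution (Set.Icc t₀ t₁) (fun t => (V t)ᵀ *ᵥ z t) (fun t => (U t)ᵀ *ᵥ u t)
          (fun t => (U t)ᵀ *ᵥ y t)) ∧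
      c.IsPHDAE (Set.Icc t₀ t₁) ∧
      IsCondensedForm c (Set.Icc t₀ t₁) ∧
      (∀ z u y, c.IsSolution (Set.Icc t₀ t₁) z u y → ∀ t ∈ Set.Icc t₀ t₁,
        (∀ a, u t ⟨2, a⟩ = 0) ∧ (∀ a, z t ⟨0, a⟩ = 0)) ∧
      (∀ z w u y, c.IsSolution (Set.Icc t₀ t₁) z u y → c.IsSolution (Set.Icc t₀ t₁) w u y →
        (∀ t ∈ Set.Icc t₀ t₁, ∀ i, i ≠ 4 → ∀ a, z t ⟨i, a⟩ = w t ⟨i, a⟩) →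
        Set.EqOn z w (Set.Icc t₀ t₁)) := by
  have hT := uniqueDiffOn_Icc ht
  obtain ⟨p, hP, hQ, hstair⟩ := hs.exists_isStaircase ht hJ hR hG hrank hinj
  choose d F hF hFP using fun i =>
    (hP i).exists_isFrame ht fun t h => (hstair t h).isStarProjection_stateProj i
  choose e H hH' hHQ using fun j =>
    (hQ j).exists_isFrame ht fun t h => (hstair t h).isStarProjection_inputProj j
  have hV := matC1On_blockCols hF
  have hVo : IsOrthogonalOn (fun t => blockCols (F · t)) (Set.Icc t₀ t₁) := fun t h =>
    ⟨transpose_blockCols_mul_of_isFrame (hFP · t h) (p t).sum_stateProj,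
      blockCols_mul_transpose_of_isFrame (hFP · t h) (p t).sum_stateProj⟩
  have hUo : IsOrthogonalOn (fun t => blockCols (H · t)) (Set.Icc t₀ t₁) := fun t h =>
    ⟨transpose_blockCols_mul_of_isFrame (hHQ · t h) (p t).sum_inputProj,
      blockCols_mul_transpose_of_isFrame (hHQ · t h) (p t).sum_inputProj⟩
  have hcong := hs.isCongruent_condense hT hstair hFP hF hH'
  have hc := hs.condense hT hFP hF hH'
  have hform := hs.isCondensedForm_condense hT hH hstair hFP hF hHQ hH'
  exact ⟨d, e, _, _, _, hV, hVo, matC1On_blockCols hH', hUo, hcong,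
    hcong.isSolution_iff hV (fun t h => (hVo t h).2) (fun t h => (hUo t h).2), hc, hform,
    fun z u y hz t h => ⟨congrFun (hform.input_two_eq_zero hz.1 h),
      congrFun (hform.state_zero_eq_zero hc hz.1 h)⟩,
    fun z w u y hz hw => hform.eqOn_of_eqOn_of_ne_four hz.1 hw.1⟩

theorem mainTheorem5 (t₀ t₁ : ℝ) (ht : t₀ < t₁) (n₁ n₂ m : ℕ)
    (s₁ : LTVSystem (Fin n₁) (Fin m)) (G₂ : ℝ → Matrix (Fin n₂) (Fin m) ℝ)
    (hpH : (s₁.augment G₂).IsPHDAE (Set.Icc t₀ t₁))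
    (hH : ∀ t ∈ Set.Icc t₀ t₁, ∀ z, 0 ≤ (s₁.augment G₂).hamiltonian t z)
    (hJ : MatC1On s₁.J (Set.Icc t₀ t₁)) (hR : MatC1On s₁.R (Set.Icc t₀ t₁))
    (hG₁ : MatC1On s₁.G (Set.Icc t₀ t₁)) (hG₂ : MatC1On G₂ (Set.Icc t₀ t₁))
    (hreg : s₁.IsRegular t₀ t₁)
    (hfull : ∀ t ∈ Set.Icc t₀ t₁, (G₂ t).rank = n₂)
    (hrank : (s₁.augment G₂).HasConstantRanks (Set.Icc t₀ t₁)) :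
    ∃ (d : Fin 6 → ℕ) (e : Fin 3 → ℕ)
      (V : ℝ → Matrix (Fin n₁ ⊕ Fin n₂) (BlockIdx d) ℝ)
      (U : ℝ → Matrix (Fin m) (BlockIdx e) ℝ)
      (c : LTVSystem (BlockIdx d) (BlockIdx e)),
      MatC1On V (Set.Icc t₀ t₁) ∧ IsOrthogonalOn V (Set.Icc t₀ t₁) ∧
      MatC1On U (Set.Icc t₀ t₁) ∧ IsOrthogonalOn U (Set.Icc t₀ t₁) ∧
      IsCongruent (s₁.augment G₂) c V U (Set.Icc t₀ t₁) ∧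
      (∀ (z : ℝ → Fin n₁ ⊕ Fin n₂ → ℝ) (u y : ℝ → Fin m → ℝ),
        (s₁.augment G₂).IsSolution (Set.Icc t₀ t₁) z u y ↔
          c.IsSolution (Set.Icc t₀ t₁) (fun t => (V t)ᵀ *ᵥ z t) (fun t => (U t)ᵀ *ᵥ u t)
            (fun t => (U t)ᵀ *ᵥ y t)) ∧
      c.IsPHDAE (Set.Icc t₀ t₁) ∧
      IsCondensedForm c (Set.Icc t₀ t₁) ∧
      (∀ z u y, c.IsSolution (Set.Icc t₀ t₁) z u y → ∀ t ∈ Set.Icc t₀ t₁,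
        (∀ a, u t ⟨2, a⟩ = 0) ∧ (∀ a, z t ⟨0, a⟩ = 0)) ∧
      (∀ z w u y, c.IsSolution (Set.Icc t₀ t₁) z u y → c.IsSolution (Set.Icc t₀ t₁) w u y →
        (∀ t ∈ Set.Icc t₀ t₁, ∀ i, i ≠ 4 → ∀ a, z t ⟨i, a⟩ = w t ⟨i, a⟩) →
        Set.EqOn z w (Set.Icc t₀ t₁)) := by
  exact mainTheorem5_general ht hpH hH (hJ.fromBlocks_zero _ _) (hR.fromBlocks_zero _ _)
    (hG₁.fromRows hG₂) hrank fun t h _ => hpH.augment_eq_zero_of_mem_algKernel ht hreg hJ hR hrank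
      h ((hfull t h).trans (Fintype.card_fin n₂).symm)
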